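/- Let $s\ge t\ge 2$ be integers. The following holds with high probability as $d\to\infty$, with $s,t$ fixed: for every $\varepsilon>0$ there is $d_0=d_0(s,t,\varepsilon)$ such that for every $d\ge d_0$, every graph $G$ of minimum degree at least $d$ that contains no (not necessarily induced) subgraph isomorphic to $K_{s,t}$, and every finite tree $T$ with at most $\frac1{64}s^{-1/(t-1)}d^{t/(t-1)}$ edges and maximum degree at most $\frac1{256}d$ (a bound that does not depend on $t$), the randomized algorithm below finds an embedding of $T$ in $G$ (an injective map $V(T)\to V(G)$ that preserves edges) with probability at least $1-\varepsilon$. Algorithm. For each vertex $v$ of $G$ fix an arbitrary set $N_+(v)$ of $d$ neighbours of $v$. Choose an arbitrary root $r$ of $T$ and embed it at an arbitrary vertex $f(r)$ of $G$. As long as $T$ is not completely embedded, take an arbitrary vertex $u$ of $T$ that is already embedded but whose children are not. If the number of vertices in $N_+(f(u))$ not yet occupied by vertices of $T$ is at least the number of children of $u$, embed the children of $u$ one by one, in an arbitrary order, each at a uniformly random vertex among those of $N_+(f(u))$ that are unoccupied at that moment, and continue; otherwise fail. The probability bound holds for every choice of the sets $N_+(v)$, of $r$ and $f(r)$, and for every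 rule making the remaining arbitrary choices (the next vertex $u$ and the order of its children), where the rule may depend on the history of the run. -/

import Mathlib

namespace TreeEmbedding

/-- In a tree `T` with root `r`, the vertex `w` is a child of `u`: it is a neighbour of `u` other
than the parent of `u`, i.e. a neighbour of `u` that does not lie on the path from `r` to `u`. -/
def IsChild {W : Type*} (T : SimpleGraph W) (r u w : W) : Prop :=
  T.Adj u w ∧ ∀ p : T.Walk r u, p.IsPath → w ∉ p.support

/-- The history of a run of the algorithm: the list of all placements `(u, f u)` made so far,
the most recent one first. -/
abbrev History (W V : Type*) := List (W × V)

/-- The tree vertex `u` has already been embedded. -/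
def Embedded {W V : Type*} (h : History W V) (u : W) : Prop :=
  ∃ x, (u, x) ∈ h

/-- The graph vertex `x` is occupied by some tree vertex. -/
def Occupied {W V : Type*} (h : History W V) (x : V) : Prop :=
  ∃ u, (u, x) ∈ h

/-- `u` is already embedded but its children are not (and there is a child to embed). -/
def Ready {W V : Type*} (T : SimpleGraph W) (r : W) (h : History W V) (u : W) : Prop :=
  Embedded h u ∧ (∃ w, IsChild T r u w) ∧ ∀ w, IsChild T r u w → ¬ Embedded h w

/-- The arbitrary choices made while the algorithm runs. After each history, `pick` says which
tree vertex is processed next (it has to be an embedded vertex whose children are not embedded,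
if there is one), and `order` says in which order its children are embedded. Both may depend on
everything that has happened so far. -/
structure Schedule {W : Type*} (T : SimpleGraph W) (r : W) (V : Type*) where
  pick : History W V → W
  order : History W V → List W
  pick_ready : ∀ h, (∃ u, Ready T r h u) → Ready T r h (pick h)
  order_nodup : ∀ h, (order h).Nodup
  mem_order : ∀ h w, w ∈ order h ↔ IsChild T r (pick h) w

open Classical in
/-- The vertices of `S` that are not occupied. -/
noncomputable def available {W V : Type*} (S : Finset V) (h : History W V) : Finset V :=
  S.filter fun x => ¬ Occupied h x

open Classical in
/-- Embed the tree vertices of a list one by one, each at a uniformly random vertex among those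
vertices of `S` that are unoccupied at that moment; `none` is failure. -/
noncomputable def placeAll {W V : Type*} (S : Finset V) :
    List W → History W V → PMF (Option (History W V))
  | [], h => PMF.pure (some h)
  | c :: cs, h =>
    if hne : (available S h).Nonempty then
      (PMF.uniformOfFinset (available S h) hne).bind fun x => placeAll S cs ((c, x) :: h)
    else PMF.pure none

open Classical in
/-- The image `f u` of `u`, if `u` is already embedded. -/
noncomputable def position {W V : Type*} (h : History W V) (u : W) : Option V :=
  h.lookup u

open Classical in
/-- One round of the algorithm: take the scheduled vertex `u`; if `N₊(f u)` contains at least as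
many unoccupied vertices as `u` has children, embed the children of `u` one by one at random
in `N₊(f u)`; otherwise fail. -/
noncomputable def round {W V : Type*} {T : SimpleGraph W} {r : W} (Nplus : V → Finset V)
    (σ : Schedule T r V) (h : History W V) : PMF (Option (History W V)) :=
  match position h (σ.pick h) with
  | none => PMF.pure none
  | some x =>
    if (σ.order h).length ≤ (available (Nplus x) h).card then
      placeAll (Nplus x) (σ.order h) h
    else PMF.pure none

open Classical in
/-- Repeat rounds until the tree is completely embedded, for at most the given number of rounds
(a run that is not complete by then counts as failed). -/
noncomputable def rounds {W V : Type*} {T : SimpleGraph W} {r : W} (Nplus : V → Finset V)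
    (σ : Schedule T r V) : ℕ → History W V → PMF (Option (History W V))
  | 0, h => if ∀ u, Embedded h u then PMF.pure (some h) else PMF.pure none
  | n + 1, h =>
    if ∀ u, Embedded h u then PMF.pure (some h)
    else (round Nplus σ h).bind fun o =>
      match o with
      | none => PMF.pure none
      | some h' => rounds Nplus σ n h'

/-- The randomized embedding algorithm, started by placing the root `r` at the vertex `x₀`. As
every successful round embeds at least one new tree vertex, `Fintype.card W` rounds are enough.
The result is the complete history of the run, or `none` if the algorithm fails. -/
noncomputable def embedTree {W V : Type*} [Fintype W] {T : SimpleGraph W} {r : W}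
    (Nplus : V → Finset V) (x₀ : V) (σ : Schedule T r V) : PMF (Option (History W V)) :=
  rounds Nplus σ (Fintype.card W) [(r, x₀)]

/-- The event that the algorithm has found an embedding: the placements of the run are exactly
the pairs `(u, f u)` of an injective edge-preserving map `f` from `T` to `G`. -/
def foundEmbedding {W V : Type*} (T : SimpleGraph W) (G : SimpleGraph V) :
    Set (Option (History W V)) :=
  {o | ∃ h, o = some h ∧ ∃ f : SimpleGraph.Copy T G, ∀ u x, (u, x) ∈ h ↔ f u = x}

end TreeEmbedding

/-! Write `k = t - 1`, `q = d^(1/k)`, `ρ = s^(1/k)`, so that `T` has at most `q d / (64 ρ)` edges.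
While at least half of every `Nplus y` is free, a child of a tree vertex at `y` lands in `Nplus v`
with probability at most `2 * overlap / d`. The danger is that some `Nplus v` fills up beyond half.

For fixed `v`, `exposure` estimates the final number of hits on `Nplus v`: a placed tree vertex
counts its actual hit, a vertex with placed parent counts twice its hit probability bound, and any
other vertex counts `κ = 17 ρ / q`. The last value is affordable because `K_{s,t}`-freeness bounds
the average overlap of a random out-neighbour of `y` with `v` by order `ρ d / q`, and because `κ *
|T|` is about `17/64 * d`. The factor two absorbs the passage from expectations to exponential
moments, so `exp (θ * exposure)` is a supermartingale for `θ = 24 log d / d`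
(`Controlled.sum_exp_exposure_cons_le`). The one uncontrolled jump, placing a tree vertex at `v`
itself, happens at most once and is prepaid by the reserve `d/64`.

A union bound over all `v` is impossible, as `G` may be huge or infinite. Only heavy `v`, those with
`touch` at least `d/16`, matter, and a weighted Kővári–Sós–Turán count (`sum_pow_weight_le`,
`card_mul_pow_le_of_touch`) leaves at most `N = O(d^2)` of them at any time. The `potential`
reserves `N` places at the price a vertex can have on becoming heavy, so it is a supermartingale
although the heavy set grows at random. A dangerous neighbourhood forces exposure `127/256 * d`,
while the entry price corresponds to `94/256 * d`. Markov's inequality bounds the failure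
probability by `N * exp (-θ * 33/256 * d)`, which is `O(1/d)`. -/

namespace TreeEmbedding

/-! ### Kővári–Sós–Turán counting -/

section Counting

open Classical

theorem card_lt_of_free {V : Type*} {G : SimpleGraph V} {s t : ℕ}
    (hfree : (completeBipartiteGraph (Fin s) (Fin t)).Free G) {I F : Finset V}
    (hI : t ≤ I.card) (h : ∀ v ∈ F, ∀ b ∈ I, G.Adj v b) : F.card < s := by
  by_contra! hs
  obtain ⟨I', hI', hIc⟩ := Finset.exists_subset_card_eq hI
  obtain ⟨F', hF', hFc⟩ := Finset.exists_subset_card_eq hs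
  refine hfree (SimpleGraph.completeBipartiteGraph_isContained_iff.2
    ⟨F', I', by simpa using hFc, by simpa using hIc, ?_⟩)
  intro v hv b hb
  exact h v (hF' (by simpa using hv)) b (hI' (by simpa using hb))

/-- A weighted form of the Kővári–Sós–Turán count: if every `j`-set lies in at most `s` of the
sets `S v`, then the `j`-th moment of their weights is bounded. -/
theorem sum_pow_weight_le {ι V : Type*} {g : V → ℝ} {γ : ℝ} (hg : ∀ b, 0 ≤ g b)
    (hγ : ∀ b, g b ≤ γ) (hγ0 : 0 ≤ γ) (U : Finset V) (s : ℕ) (j : ℕ) :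
    ∀ (F : Finset ι) (S : ι → Finset V), (∀ v ∈ F, S v ⊆ U) →
      (∀ I : Finset V, I.card = j → (F.filter fun v => I ⊆ S v).card ≤ s) →
      ∑ v ∈ F, (max (∑ b ∈ S v, g b - ((j : ℝ) - 1) * γ) 0) ^ j ≤ s * (∑ b ∈ U, g b) ^ j := by
  induction j with
  | zero =>
    intro F S _ h
    have := h ∅ rfl
    simp only [Finset.empty_subset, Finset.filter_true] at this
    simpa using this
  | succ j ih =>
    intro F S hS h
    -- One factor of the power is expanded as a sum over `b ∈ S v`. Deleting `b` from `S v` costs at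
    -- most `γ`, which is why the threshold drops by one `γ` per induction step.
    have key : ∀ v ∈ F, (max (∑ b ∈ S v, g b - (((j + 1 : ℕ) : ℝ) - 1) * γ) 0) ^ (j + 1) ≤
        ∑ b ∈ U, if b ∈ S v then
          g b * (max (∑ c ∈ S v \ {b}, g c - ((j : ℝ) - 1) * γ) 0) ^ j else 0 := by
      intro v hv
      rw [← Finset.sum_filter, Finset.filter_mem_eq_inter, Finset.inter_eq_right.2 (hS v hv)]
      have hw : 0 ≤ ∑ b ∈ S v, g b := Finset.sum_nonneg fun b _ => hg b
      have hj : 0 ≤ (j : ℝ) * γ := by positivity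
      have hcast : (((j + 1 : ℕ) : ℝ) - 1) * γ = j * γ := by push_cast; ring
      rw [hcast, pow_succ']
      calc max (∑ b ∈ S v, g b - j * γ) 0 * (max (∑ b ∈ S v, g b - j * γ) 0) ^ j
          ≤ (∑ b ∈ S v, g b) * (max (∑ b ∈ S v, g b - j * γ) 0) ^ j := by
            gcongr
            exact max_le (by linarith) hw
        _ = ∑ b ∈ S v, g b * (max (∑ b ∈ S v, g b - j * γ) 0) ^ j := Finset.sum_mul ..
        _ ≤ _ := by
            refine Finset.sum_le_sum fun b hb => ?_
            refine mul_le_mul_of_nonneg_left ?_ (hg b)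
            refine pow_le_pow_left₀ (le_max_right _ _) (max_le_max ?_ le_rfl) _
            have h1 : ∑ c ∈ S v \ {b}, g c + ∑ c ∈ {b}, g c = ∑ c ∈ S v, g c :=
              Finset.sum_sdiff (by simpa using hb)
            rw [Finset.sum_singleton] at h1
            linarith [hγ b]
    calc _ ≤ ∑ v ∈ F, ∑ b ∈ U, (if b ∈ S v then
          g b * (max (∑ c ∈ S v \ {b}, g c - ((j : ℝ) - 1) * γ) 0) ^ j else 0) :=
            Finset.sum_le_sum key
      _ = ∑ b ∈ U, ∑ v ∈ F, (if b ∈ S v then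
          g b * (max (∑ c ∈ S v \ {b}, g c - ((j : ℝ) - 1) * γ) 0) ^ j else 0) :=
            Finset.sum_comm
      _ ≤ ∑ b ∈ U, g b * (s * (∑ b ∈ U, g b) ^ j) := by
            refine Finset.sum_le_sum fun b _ => ?_
            rw [← Finset.sum_filter, ← Finset.mul_sum]
            refine mul_le_mul_of_nonneg_left ?_ (hg b)
            refine ih _ (fun v => S v \ {b}) ?_ ?_
            · intro v hv
              exact Finset.sdiff_subset.trans (hS v (Finset.mem_filter.1 hv).1)
            -- If `b ∉ I`, a set counted here contains `insert b I`, a set of size `j + 1`; if `b ∈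
            -- I`, nothing is counted.
            · intro I hI
              by_cases hb : b ∈ I
              · rw [Finset.card_eq_zero.2]
                · exact Nat.zero_le _
                · refine Finset.filter_eq_empty_iff.2 fun v _ hIv => ?_
                  have := hIv hb
                  simp at this
              · refine le_trans (Finset.card_le_card ?_)
                  (h (insert b I) (by rw [Finset.card_insert_of_notMem hb, hI]))
                intro v hv
                simp only [Finset.mem_filter] at hv ⊢
                refine ⟨hv.1.1, Finset.insert_subset hv.1.2 (hv.2.trans Finset.sdiff_subset)⟩
      _ = _ := by rw [← Finset.sum_mul, pow_succ]; ring

/-- The number of common out-neighbours of two vertices. -/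
noncomputable def overlap {V : Type*} (Nplus : V → Finset V) (x v : V) : ℕ :=
  (Nplus x ∩ Nplus v).card

theorem overlap_le {V : Type*} {Nplus : V → Finset V} {d : ℕ} (hd : ∀ v, (Nplus v).card = d)
    (x v : V) : overlap Nplus x v ≤ d :=
  (Finset.card_le_card Finset.inter_subset_left).trans (hd x).le

theorem overlap_lt_of_free {V : Type*} {G : SimpleGraph V} {s : ℕ}
    (hfree : (completeBipartiteGraph (Fin s) (Fin 2)).Free G) {Nplus : V → Finset V}
    (hN : ∀ v, (Nplus v : Set V) ⊆ G.neighborSet v) {x v : V} (hxv : x ≠ v) :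
    overlap Nplus x v < s := by
  refine card_lt_of_free hfree (I := {x, v}) (by rw [Finset.card_pair hxv]) ?_
  intro b hb c hc
  have h1 := hN x (by simpa using (Finset.mem_inter.1 hb).1)
  have h2 := hN v (by simpa using (Finset.mem_inter.1 hb).2)
  simp only [SimpleGraph.mem_neighborSet] at h1 h2
  rcases Finset.mem_insert.1 hc with rfl | hc
  · exact h1.symm
  · rw [Finset.mem_singleton.1 hc]; exact h2.symm

/-- All `x ∈ A` are adjacent to `y`, so a `k`-set of `Nplus v` avoiding `y` lies in fewer than `s`
of the sets `Nplus x`: together with `y` it has `k + 1` elements. Removing `y` lowers an overlap by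
at most one, hence the shift by `k` instead of `k - 1`. -/
theorem sum_overlap_pow_le {V : Type*} {G : SimpleGraph V} {s k : ℕ}
    (hfree : (completeBipartiteGraph (Fin s) (Fin (k + 1))).Free G) {Nplus : V → Finset V} {d : ℕ}
    (hd : ∀ v, (Nplus v).card = d)
    (hN : ∀ v, (Nplus v : Set V) ⊆ G.neighborSet v) {y v : V} {A : Finset V}
    (hA : A ⊆ Nplus y) :
    ∑ x ∈ A, (max ((overlap Nplus x v : ℝ) - k) 0) ^ k ≤ s * (d : ℝ) ^ k := by
  have h := sum_pow_weight_le (g := fun _ : V => (1 : ℝ)) (γ := 1) (by simp) (by simp) (by simp)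
    (Nplus v) s k A (fun x => (Nplus x ∩ Nplus v) \ {y})
    (fun x _ => Finset.sdiff_subset.trans Finset.inter_subset_right) ?_
  · refine le_trans (Finset.sum_le_sum fun x _ => ?_) (h.trans (by simp [hd]))
    refine pow_le_pow_left₀ (le_max_right _ _) (max_le_max ?_ le_rfl) _
    have h1 : overlap Nplus x v ≤ ((Nplus x ∩ Nplus v) \ {y}).card + 1 := by
      have := Finset.le_card_sdiff {y} (Nplus x ∩ Nplus v)
      rw [Finset.card_singleton] at this
      unfold overlap; omega
    have h2 : (overlap Nplus x v : ℝ) ≤ ((Nplus x ∩ Nplus v) \ {y}).card + 1 := by exact_mod_cast h1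
    simp only [Finset.sum_const, nsmul_eq_mul, mul_one]
    linarith
  · intro I hI
    by_cases hy : y ∈ I
    · rw [Finset.card_eq_zero.2]
      · exact Nat.zero_le _
      · refine Finset.filter_eq_empty_iff.2 fun v _ hIv => ?_
        have := hIv hy
        simp at this
    · refine (card_lt_of_free hfree (I := insert y I)
        (by rw [Finset.card_insert_of_notMem hy, hI]) ?_).le
      intro x hx b hb
      rw [Finset.mem_filter] at hx
      rcases Finset.mem_insert.1 hb with rfl | hb
      · exact (hN _ (by simpa using hA hx.1) : G.Adj _ x).symm
      · have := hx.2 hb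
        simp only [Finset.mem_sdiff, Finset.mem_inter] at this
        exact hN x (by simpa using this.1.1)

end Counting

/-! ### Exponential moments of overlaps -/

section Moments

open Classical

/-- For `L * X ≤ 1` the linear terms suffice; otherwise `(L * X) ^ k ≥ 1` and `exp L` is enough. The
large factor `exp L` thus multiplies only a high moment of `X`. -/
theorem exp_mul_le {L X : ℝ} (hL : 0 ≤ L) (hX0 : 0 ≤ X) (hX1 : X ≤ 1) (k : ℕ) :
    Real.exp (L * X) ≤ 1 + 2 * (L * X) + Real.exp L * (L * X) ^ k := by
  have h0 : 0 ≤ L * X := mul_nonneg hL hX0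
  rcases le_total (L * X) 1 with h | h
  · have := Real.abs_exp_sub_one_le (x := L * X) (by rwa [abs_of_nonneg h0])
    rw [abs_of_nonneg h0] at this
    have h1 := (abs_le.1 this).2
    have : 0 ≤ Real.exp L * (L * X) ^ k := by positivity
    linarith
  · have h1 : Real.exp (L * X) ≤ Real.exp L := Real.exp_le_exp.2 (mul_le_of_le_one_right hL hX1)
    have h2 : Real.exp L ≤ Real.exp L * (L * X) ^ k :=
      le_mul_of_one_le_right (Real.exp_pos _).le (one_le_pow₀ h)
    linarith

/-- The one-step estimate behind the supermartingale. Linearising the exponentials doubles the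
means: `P / 2` becomes `P`, and the first moment `m` with coefficient `4 * θ * c` becomes `8 * m`.
The number `c` stands for the number of children of the vertex being placed. -/
theorem sum_exp_le {V : Type*} {A : Finset V} {hit X : V → ℝ} {θ c κ P m M Lmax : ℝ} {k : ℕ}
    (hθ0 : 0 ≤ θ) (hθ1 : θ ≤ 1) (hc : 0 ≤ c) (hLmax : 4 * θ * c ≤ Lmax) (hM0 : 0 ≤ M)
    (hh0 : ∀ x ∈ A, 0 ≤ hit x) (hh1 : ∀ x ∈ A, hit x ≤ 1)
    (hX0 : ∀ x ∈ A, 0 ≤ X x) (hX1 : ∀ x ∈ A, X x ≤ 1)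
    (hhit : ∑ x ∈ A, hit x ≤ A.card * (P / 2)) (hm : ∑ x ∈ A, X x ≤ A.card * m)
    (hM : ∑ x ∈ A, X x ^ (k + 1) ≤ A.card * M)
    (hκ : (1 + 2 * θ) * (8 * m + 4 * (Real.exp Lmax * Lmax ^ k * M)) ≤ κ) :
    ∑ x ∈ A, Real.exp (θ * hit x + 4 * θ * c * X x) ≤
      A.card * Real.exp (θ * P + θ * c * κ) := by
  set L := 4 * θ * c with hL
  have hL0 : 0 ≤ L := by positivity
  have hpt : ∀ x ∈ A, Real.exp (θ * hit x + L * X x) ≤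
      1 + 2 * θ * hit x + (1 + 2 * θ) * (2 * L * X x + Real.exp L * L ^ (k + 1) * X x ^ (k + 1)) := by
    intro x hx
    have h0 := hh0 x hx
    have h1 := hh1 x hx
    have e1 : Real.exp (θ * hit x) ≤ 1 + 2 * θ * hit x := by
      have hb : θ * hit x ≤ 1 := mul_le_one₀ hθ1 h0 h1
      have hb0 : 0 ≤ θ * hit x := by positivity
      have := (abs_le.1 (Real.abs_exp_sub_one_le (x := θ * hit x) (by rwa [abs_of_nonneg hb0]))).2
      rw [abs_of_nonneg hb0] at this
      linarith
    have e2 := exp_mul_le hL0 (hX0 x hx) (hX1 x hx) (k + 1)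
    rw [mul_pow] at e2
    have hZ : 0 ≤ 2 * L * X x + Real.exp L * L ^ (k + 1) * X x ^ (k + 1) := by
      have := hX0 x hx
      positivity
    have e3 : 1 + 2 * θ * hit x ≤ 1 + 2 * θ := by nlinarith
    rw [Real.exp_add]
    calc Real.exp (θ * hit x) * Real.exp (L * X x)
        ≤ (1 + 2 * θ * hit x) * (1 + (2 * L * X x + Real.exp L * L ^ (k + 1) * X x ^ (k + 1))) := by
          refine mul_le_mul e1 (by linarith) (Real.exp_pos _).le ?_
          exact (Real.exp_pos _).le.trans e1
      _ ≤ _ := by nlinarith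
  have hLk : 2 * L * m + Real.exp L * L ^ (k + 1) * M ≤
      θ * c * (8 * m + 4 * (Real.exp Lmax * Lmax ^ k * M)) := by
    have : Real.exp L * L ^ k * M ≤ Real.exp Lmax * Lmax ^ k * M := by gcongr
    have h2 : Real.exp L * L ^ (k + 1) * M = 4 * (θ * c) * (Real.exp L * L ^ k * M) := by
      rw [pow_succ]; simp only [hL]; ring
    have h3 : 2 * L * m = θ * c * (8 * m) := by simp only [hL]; ring
    rw [h2, h3]
    have := mul_le_mul_of_nonneg_left this (show 0 ≤ 4 * (θ * c) by positivity)
    linarith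
  have hA0 : (0 : ℝ) ≤ A.card := by positivity
  calc _ ≤ ∑ x ∈ A, (1 + 2 * θ * hit x + (1 + 2 * θ) *
        (2 * L * X x + Real.exp L * L ^ (k + 1) * X x ^ (k + 1))) := Finset.sum_le_sum hpt
    _ = A.card + 2 * θ * ∑ x ∈ A, hit x + (1 + 2 * θ) *
        (2 * L * ∑ x ∈ A, X x + Real.exp L * L ^ (k + 1) * ∑ x ∈ A, X x ^ (k + 1)) := by
        simp only [Finset.sum_add_distrib, ← Finset.mul_sum, Finset.sum_const, nsmul_eq_mul, mul_one]
    _ ≤ A.card + 2 * θ * (A.card * (P / 2)) + (1 + 2 * θ) *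
        (2 * L * (A.card * m) + Real.exp L * L ^ (k + 1) * (A.card * M)) := by gcongr
    _ = A.card * (1 + θ * P + (1 + 2 * θ) * (2 * L * m + Real.exp L * L ^ (k + 1) * M)) := by ring
    _ ≤ A.card * (1 + θ * P + (1 + 2 * θ) *
          (θ * c * (8 * m + 4 * (Real.exp Lmax * Lmax ^ k * M)))) := by gcongr
    _ ≤ A.card * (1 + θ * P + θ * c * κ) := by
        have := mul_le_mul_of_nonneg_left hκ (show 0 ≤ θ * c by positivity)
        refine mul_le_mul_of_nonneg_left ?_ hA0
        linarith
    _ ≤ _ := by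
        gcongr
        have := Real.add_one_le_exp (θ * P + θ * c * κ)
        linarith

/-- The normalised overlap of `x` with `v`, where `x = v` itself is disregarded. -/
noncomputable def relOverlap {V : Type*} (Nplus : V → Finset V) (d : ℕ) (v x : V) : ℝ :=
  if x = v then 0 else (overlap Nplus x v : ℝ) / d

theorem relOverlap_nonneg {V : Type*} (Nplus : V → Finset V) (d : ℕ) (v x : V) :
    0 ≤ relOverlap Nplus d v x := by
  unfold relOverlap; split_ifs <;> positivity

theorem relOverlap_le_one {V : Type*} {Nplus : V → Finset V} {d : ℕ}
    (hd : ∀ v, (Nplus v).card = d) (v x : V) : relOverlap Nplus d v x ≤ 1 := by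
  unfold relOverlap; split_ifs
  · exact zero_le_one
  · exact div_le_one_of_le₀ (by exact_mod_cast overlap_le hd x v) (by positivity)

theorem relOverlap_le_div {V : Type*} (Nplus : V → Finset V) (d : ℕ) (v x : V) :
    relOverlap Nplus d v x ≤ (overlap Nplus x v : ℝ) / d := by
  unfold relOverlap; split_ifs
  · positivity
  · exact le_rfl

theorem relOverlap_le_of_free {V : Type*} {G : SimpleGraph V} {s d : ℕ}
    (hfree : (completeBipartiteGraph (Fin s) (Fin 2)).Free G) {Nplus : V → Finset V}
    (hN : ∀ v, (Nplus v : Set V) ⊆ G.neighborSet v) (v x : V) :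
    relOverlap Nplus d v x ≤ s / d := by
  unfold relOverlap; split_ifs with h
  · positivity
  · gcongr
    exact (overlap_lt_of_free hfree hN h).le

/-- The `k`-th moment sum of normalised overlaps is bounded independently of `d`, and `1 ≤ 2 *
A.card / d` turns this into an average of order `1 / d`. -/
theorem sum_relOverlap_pow_le {V : Type*} {G : SimpleGraph V} {s k d : ℕ}
    (hfree : (completeBipartiteGraph (Fin s) (Fin (k + 1))).Free G) {Nplus : V → Finset V}
    (hcard : ∀ v, (Nplus v).card = d) (hN : ∀ v, (Nplus v : Set V) ⊆ G.neighborSet v)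
    (hk : 1 ≤ k) (hd : 1 ≤ d) {y v : V} {A : Finset V} (hA : A ⊆ Nplus y)
    (hAd : (d : ℝ) ≤ 2 * A.card) :
    ∑ x ∈ A, relOverlap Nplus d v x ^ k ≤ A.card * (2 ^ k * (2 * s + k ^ k) / d) := by
  have hd' : (1 : ℝ) ≤ d := by exact_mod_cast hd
  obtain ⟨j, rfl⟩ : ∃ j, k = j + 1 := ⟨k - 1, by omega⟩
  set k := j + 1
  have hmom := sum_overlap_pow_le hfree hcard hN (v := v) hA
  set Y : V → ℝ := fun x => max ((overlap Nplus x v : ℝ) - k) 0 with hY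
  have hpt : ∀ x ∈ A, relOverlap Nplus d v x ^ k ≤ 2 ^ k * (Y x ^ k + k ^ k) / (d : ℝ) ^ k := by
    intro x _
    calc relOverlap Nplus d v x ^ k ≤ ((overlap Nplus x v : ℝ) / d) ^ k :=
          pow_le_pow_left₀ (relOverlap_nonneg ..) (relOverlap_le_div ..) _
      _ = (overlap Nplus x v : ℝ) ^ k / (d : ℝ) ^ k := div_pow _ _ _
      _ ≤ (Y x + k) ^ k / (d : ℝ) ^ k := by
          gcongr
          have := le_max_left ((overlap Nplus x v : ℝ) - k) 0
          simp only [hY]; linarith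
      _ ≤ _ := by
          have h0 : 0 ≤ Y x := le_max_right _ _
          gcongr
          refine (add_pow_le h0 (by positivity) k).trans ?_
          gcongr
          · norm_num
          · omega
  have hd0 : (0 : ℝ) < d := by linarith
  calc _ ≤ ∑ x ∈ A, 2 ^ k * (Y x ^ k + k ^ k) / (d : ℝ) ^ k := Finset.sum_le_sum hpt
    _ = 2 ^ k * (∑ x ∈ A, Y x ^ k + A.card * (k : ℝ) ^ k) / (d : ℝ) ^ k := by
        rw [← Finset.sum_div, ← Finset.mul_sum, Finset.sum_add_distrib, Finset.sum_const,
          nsmul_eq_mul]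
    _ ≤ 2 ^ k * (s * (d : ℝ) ^ k + A.card * (k : ℝ) ^ k) / (d : ℝ) ^ k := by gcongr
    _ ≤ 2 ^ k * (s * ((d : ℝ) ^ j * (2 * A.card)) + A.card * (k : ℝ) ^ k * (d : ℝ) ^ j)
          / (d : ℝ) ^ k := by
        rw [show (d : ℝ) ^ k = (d : ℝ) ^ j * d from pow_succ _ _]
        have h1 : A.card * (k : ℝ) ^ k ≤ A.card * (k : ℝ) ^ k * (d : ℝ) ^ j :=
          le_mul_of_one_le_right (by positivity) (one_le_pow₀ hd')
        gcongr
    _ = _ := by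
        rw [show (d : ℝ) ^ k = (d : ℝ) ^ j * d from pow_succ _ _]
        field_simp

/-- The power mean inequality converts the `k`-th moment into a first moment, with `ρ / q` (here `r
/ q`) appearing as the `k`-th root of `s / d`. -/
theorem sum_relOverlap_le {V : Type*} {G : SimpleGraph V} {s k d : ℕ}
    (hfree : (completeBipartiteGraph (Fin s) (Fin (k + 1))).Free G) {Nplus : V → Finset V}
    (hcard : ∀ v, (Nplus v).card = d) (hN : ∀ v, (Nplus v : Set V) ⊆ G.neighborSet v)
    (hk : 2 ≤ k) (hd : 1 ≤ d) {y v : V} {A : Finset V} (hA : A ⊆ Nplus y)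
    (hAd : (d : ℝ) ≤ 2 * A.card) {q r : ℝ} (hq : 0 < q) (hqk : q ^ k = d) (hr : 1 ≤ r)
    (hrk : r ^ k = s) (hqd : 2 * k * q ≤ d) :
    ∑ x ∈ A, relOverlap Nplus d v x ≤ A.card * (2 * r / q) := by
  have hd' : (1 : ℝ) ≤ d := by exact_mod_cast hd
  have hd0 : (0 : ℝ) < d := by linarith
  obtain ⟨j, rfl⟩ : ∃ j, k = j + 1 := ⟨k - 1, by omega⟩
  set k := j + 1
  have hmom := sum_overlap_pow_le hfree hcard hN (v := v) hA
  set Y : V → ℝ := fun x => max ((overlap Nplus x v : ℝ) - k) 0 with hY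
  have hA0 : (0 : ℝ) < A.card := by linarith
  have hYsum : ∑ x ∈ A, Y x ≤ A.card * (3 / 2 * r * d / q) := by
    refine le_of_pow_le_pow_left₀ (n := k) (by omega) (by positivity) ?_
    have h1 := pow_sum_div_card_le_sum_pow (s := A) (f := Y) (fun x _ => le_max_right _ _) j
    rw [div_le_iff₀ (by positivity)] at h1
    -- The factor `3/2` absorbs the loss `d ≤ 2 * A.card`, which needs `k ≥ 2`. The other `1/2` of
    -- the final constant `2` pays for the shift by `k`.
    have h32 : (2 : ℝ) ≤ (3 / 2) ^ k := by
      calc (2 : ℝ) ≤ (3 / 2) ^ 2 := by norm_num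
        _ ≤ (3 / 2) ^ k := pow_le_pow_right₀ (by norm_num) hk
    calc (∑ x ∈ A, Y x) ^ k ≤ (∑ x ∈ A, Y x ^ k) * (A.card : ℝ) ^ j := h1
      _ ≤ (s * (d : ℝ) ^ k) * (A.card : ℝ) ^ j := by gcongr
      _ = (A.card : ℝ) ^ j * s * (d : ℝ) ^ j * d := by rw [show (d : ℝ) ^ k = (d : ℝ) ^ j * d from pow_succ _ _]; ring
      _ ≤ (A.card : ℝ) ^ j * s * (d : ℝ) ^ j * ((3 / 2) ^ k * A.card) := by
          gcongr
          exact hAd.trans (by gcongr)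
      _ = (A.card * (3 / 2 * r * d / q)) ^ k := by
          rw [mul_pow, div_pow (3 / 2 * r * d) q, mul_pow, mul_pow, hqk, hrk, show (d : ℝ) ^ k = (d : ℝ) ^ j * d from pow_succ _ _,
            show (A.card : ℝ) ^ k = (A.card : ℝ) ^ j * A.card from pow_succ _ _]
          field_simp
  calc ∑ x ∈ A, relOverlap Nplus d v x ≤ ∑ x ∈ A, (Y x + k) / d := by
        refine Finset.sum_le_sum fun x _ => (relOverlap_le_div ..).trans ?_
        gcongr
        have := le_max_left ((overlap Nplus x v : ℝ) - k) 0
        simp only [hY]; linarith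
    _ = (∑ x ∈ A, Y x + A.card * k) / d := by
        rw [← Finset.sum_div, Finset.sum_add_distrib, Finset.sum_const, nsmul_eq_mul]
    _ ≤ (A.card * (3 / 2 * r * d / q) + A.card * k) / d := by gcongr
    _ = A.card * (3 / 2 * r / q + k / d) := by field_simp
    _ ≤ A.card * (3 / 2 * r / q + 1 / 2 * r / q) := by
        refine mul_le_mul_of_nonneg_left ?_ hA0.le
        refine add_le_add le_rfl ?_
        rw [div_le_div_iff₀ hd0 hq]
        nlinarith
    _ = _ := by ring

end Moments

/-! ### Parents and children in a rooted tree -/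

theorem dist_eq_length_of_isPath {W : Type*} {T : SimpleGraph W} (hT : T.IsTree) {a b : W}
    {p : T.Walk a b} (hp : p.IsPath) : p.length = T.dist a b := by
  obtain ⟨q, hq, hql⟩ := (hT.connected a b).exists_path_of_dist
  rw [(hT.existsUnique_path a b).unique hp hq, hql]

theorem isChild_iff_dist {W : Type*} {T : SimpleGraph W} (hT : T.IsTree) (r u w : W) :
    IsChild T r u w ↔ T.Adj u w ∧ T.dist r w = T.dist r u + 1 := by
  classical
  constructor
  · rintro ⟨hadj, h⟩
    obtain ⟨p, hp, hpl⟩ := (hT.connected r u).exists_path_of_dist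
    refine ⟨hadj, ?_⟩
    rw [← dist_eq_length_of_isPath hT (hp.concat (h p hp) hadj), SimpleGraph.Walk.length_concat, hpl]
  · rintro ⟨hadj, h⟩
    refine ⟨hadj, fun p hp hw => ?_⟩
    have h1 := dist_eq_length_of_isPath hT hp
    have h2 := dist_eq_length_of_isPath hT (hp.takeUntil hw)
    have h3 := p.length_takeUntil_le_length hw
    omega

theorem IsChild.unique {W : Type*} {T : SimpleGraph W} (hT : T.IsTree) {r u u' w : W}
    (h : IsChild T r u w) (h' : IsChild T r u' w) : u = u' := by
  obtain ⟨p, hp, -⟩ := (hT.connected r u).exists_path_of_dist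
  obtain ⟨p', hp', -⟩ := (hT.connected r u').exists_path_of_dist
  have := (hT.existsUnique_path r w).unique (hp.concat (h.2 p hp) h.1)
    (hp'.concat (h'.2 p' hp') h'.1)
  have := congrArg SimpleGraph.Walk.penultimate this
  simpa using this

theorem exists_isChild {W : Type*} {T : SimpleGraph W} (hT : T.IsTree) {r w : W} (hw : w ≠ r) :
    ∃ u, IsChild T r u w := by
  obtain ⟨n, hn⟩ : ∃ n, T.dist r w = n + 1 :=
    Nat.exists_eq_succ_of_ne_zero ((hT.connected r w).pos_dist_of_ne hw.symm).ne'
  obtain ⟨p, hp, hpl⟩ := (hT.connected r w).exists_path_of_dist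
  have hnil : ¬ p.Nil := by
    rw [SimpleGraph.Walk.not_nil_iff_lt_length]; omega
  refine ⟨p.penultimate, (isChild_iff_dist hT r _ w).2 ⟨p.adj_penultimate hnil, ?_⟩⟩
  have h1 : T.dist r p.penultimate ≤ p.length - 1 := by
    have := SimpleGraph.dist_le p.dropLast
    simpa using this
  rcases hT.dist_eq_dist_add_one_of_adj r (p.adj_penultimate hnil) with h | h <;> omega

/-- `par` sends every vertex of the tree `T` rooted at `r` to its parent, and `r` to itself. -/
structure IsParentMap {W : Type*} (T : SimpleGraph W) (r : W) (par : W → W) : Prop where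
  root : par r = r
  isChild_iff : ∀ u w, IsChild T r u w ↔ w ≠ r ∧ par w = u
  adj : ∀ w, w ≠ r → T.Adj (par w) w
  dist_lt : ∀ w, w ≠ r → T.dist r (par w) < T.dist r w
  eq_or_eq : ∀ a b, T.Adj a b → (b ≠ r ∧ par b = a) ∨ (a ≠ r ∧ par a = b)

theorem exists_isParentMap {W : Type*} {T : SimpleGraph W} (hT : T.IsTree) (r : W) :
    ∃ par : W → W, IsParentMap T r par := by
  classical
  have hroot : ∀ u, ¬ IsChild T r u r := by
    intro u h
    have := ((isChild_iff_dist hT r u r).1 h).2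
    simp at this
  have hiff : ∀ u w, IsChild T r u w ↔
      w ≠ r ∧ (if h : w = r then r else (exists_isChild hT h).choose) = u := by
    intro u w
    by_cases h : w = r
    · simp only [h, ne_eq, not_true, false_and, iff_false]
      exact hroot u
    · have hc := (exists_isChild hT h).choose_spec
      simp only [h, ne_eq, not_false_eq_true, true_and, dif_neg]
      exact ⟨fun h' => hc.unique hT h', fun h' => h' ▸ hc⟩
  refine ⟨_, ⟨by simp, hiff, fun w hw => ((hiff _ w).2 ⟨hw, rfl⟩).1, fun w hw => ?_, ?_⟩⟩
  · have := ((isChild_iff_dist hT r _ w).1 ((hiff _ w).2 ⟨hw, rfl⟩)).2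
    omega
  · intro a b hab
    rw [← hiff, ← hiff, isChild_iff_dist hT, isChild_iff_dist hT]
    rcases hT.dist_eq_dist_add_one_of_adj r hab with h | h
    · exact Or.inr ⟨hab.symm, h⟩
    · exact Or.inl ⟨hab, h⟩

/-! ### Exposure, heavy vertices and the supermartingale -/

section Potential

open Classical

variable {V W : Type*}

theorem position_cons (h : History W V) (c : W) (x : V) (u : W) :
    position ((c, x) :: h) u = if u = c then some x else position h u := by
  unfold position
  rw [List.lookup_cons]
  by_cases huc : u = c
  · simp [huc]
  · have : (u == c) = false := by simpa using huc
    rw [this, if_neg huc]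

theorem position_cons_of_ne {h : History W V} {c u : W} {x : V} (hu : u ≠ c) :
    position ((c, x) :: h) u = position h u := by
  rw [position_cons, if_neg hu]

theorem position_cons_self (h : History W V) (c : W) (x : V) :
    position ((c, x) :: h) c = some x := by
  rw [position_cons, if_pos rfl]

theorem position_singleton (r : W) (x₀ : V) (u : W) :
    position [(r, x₀)] u = if u = r then some x₀ else none := by
  rw [position_cons]
  rfl

theorem occupied_cons {h : History W V} {c : W} {x v : V} :
    Occupied ((c, x) :: h) v ↔ v = x ∨ Occupied h v := by
  simp only [Occupied, List.mem_cons, Prod.mk.injEq]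
  constructor
  · rintro ⟨u, ⟨-, h⟩ | h⟩
    · exact Or.inl h
    · exact Or.inr ⟨u, h⟩
  · rintro (h | ⟨u, h⟩)
    · exact ⟨c, Or.inl ⟨rfl, h⟩⟩
    · exact ⟨u, Or.inr h⟩

/-- A history that describes a partial embedding, closed under taking parents. -/
structure Valid (Nplus : V → Finset V) (r : W) (par : W → W) (h : History W V) : Prop where
  mem_iff : ∀ u x, (u, x) ∈ h ↔ position h u = some x
  inj : ∀ u u' x, position h u = some x → position h u' = some x → u = u'
  root : position h r ≠ none
  edge : ∀ w x, w ≠ r → position h w = some x → ∃ y, position h (par w) = some y ∧ x ∈ Nplus y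

theorem Valid.embedded_iff {Nplus : V → Finset V} {r : W} {par : W → W} {h : History W V}
    (hv : Valid Nplus r par h) (u : W) : Embedded h u ↔ position h u ≠ none := by
  simp only [Embedded, hv.mem_iff, Option.ne_none_iff_exists']

theorem Valid.occupied_iff {Nplus : V → Finset V} {r : W} {par : W → W} {h : History W V}
    (hv : Valid Nplus r par h) (x : V) : Occupied h x ↔ ∃ u, position h u = some x := by
  simp only [Occupied, hv.mem_iff]

theorem valid_singleton (Nplus : V → Finset V) (r : W) (par : W → W) (x₀ : V) :
    Valid Nplus r par [(r, x₀)] := by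
  have hp : ∀ u, position [(r, x₀)] u = if u = r then some x₀ else none :=
    position_singleton r x₀
  refine ⟨fun u x => ?_, fun u u' x h h' => ?_, ?_, fun w x hw h => ?_⟩
  · rw [hp]
    by_cases hu : u = r
    · simp [hu, eq_comm]
    · simp [hu]
  · rw [hp] at h h'
    split_ifs at h h' with h1 h2
    rw [h1, h2]
  · simp [hp]
  · rw [hp, if_neg hw] at h
    simp at h

theorem Valid.cons {Nplus : V → Finset V} {r : W} {par : W → W} {h : History W V}
    (hv : Valid Nplus r par h) {c : W} {x y : V} (hc : position h c = none)
    (hy : position h (par c) = some y) (hx : x ∈ available (Nplus y) h) :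
    Valid Nplus r par ((c, x) :: h) := by
  have hx' := Finset.mem_filter.1 hx
  have hocc := hx'.2
  rw [hv.occupied_iff] at hocc
  push Not at hocc
  refine ⟨fun u z => ?_, fun u u' z h1 h2 => ?_, ?_, fun w z hw hz => ?_⟩
  · rw [List.mem_cons, Prod.mk.injEq, hv.mem_iff, position_cons]
    by_cases hu : u = c
    · subst hu
      simp [hc, eq_comm]
    · simp [hu]
  · rw [position_cons] at h1 h2
    split_ifs at h1 h2 with h3 h4 h4
    · rw [h3, h4]
    · cases h1; exact absurd h2 (hocc _)
    · cases h2; exact absurd h1 (hocc _)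
    · exact hv.inj _ _ _ h1 h2
  · rw [position_cons]
    split_ifs
    · simp
    · exact hv.root
  · rw [position_cons] at hz
    have hne : ∀ w, position h w ≠ none → w ≠ c := by
      rintro w hw rfl
      exact hw hc
    split_ifs at hz with h1
    · cases hz
      subst h1
      exact ⟨y, by rw [position_cons_of_ne (hne _ (by simp [hy]))]; exact hy, hx'.1⟩
    · obtain ⟨y', hy', hzy⟩ := hv.edge w z hw hz
      exact ⟨y', by rw [position_cons_of_ne (hne _ (by simp [hy']))]; exact hy', hzy⟩

/-- The indicator of placing a tree vertex in the out-neighbourhood of `v`. -/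
noncomputable def hit (Nplus : V → Finset V) (v x : V) : ℝ := if x ∈ Nplus v then 1 else 0

theorem hit_nonneg (Nplus : V → Finset V) (v x : V) : 0 ≤ hit Nplus v x := by
  unfold hit; split_ifs <;> norm_num

theorem hit_le_one (Nplus : V → Finset V) (v x : V) : hit Nplus v x ≤ 1 := by
  unfold hit; split_ifs <;> norm_num

/-- Twice a bound on the probability that a child of a tree vertex at `y` hits the
out-neighbourhood of `v`. -/
noncomputable def threat (Nplus : V → Finset V) (d : ℕ) (v y : V) : ℝ :=
  4 * ((overlap Nplus y v : ℝ) / d)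

theorem threat_nonneg (Nplus : V → Finset V) (d : ℕ) (v y : V) : 0 ≤ threat Nplus d v y := by
  unfold threat; positivity

theorem threat_le {Nplus : V → Finset V} {d : ℕ} (hd : ∀ v, (Nplus v).card = d) (v y : V) :
    threat Nplus d v y ≤ 4 := by
  unfold threat
  have : (overlap Nplus y v : ℝ) / d ≤ 1 :=
    div_le_one_of_le₀ (by exact_mod_cast overlap_le hd y v) (by positivity)
  linarith

/-- The contribution of the tree vertex `c` to the exposure of `v`. -/
noncomputable def load (Nplus : V → Finset V) (par : W → W) (d : ℕ) (κ : ℝ) (v : V)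
    (h : History W V) (c : W) : ℝ :=
  (position h c).elim ((position h (par c)).elim κ (threat Nplus d v)) (hit Nplus v)

/-- The part of the load of `c` that is caused by vertices already placed; unlike the load, it
never decreases during a run. -/
noncomputable def touchAt (Nplus : V → Finset V) (par : W → W) (d : ℕ) (v : V)
    (h : History W V) (c : W) : ℝ :=
  (position h c).elim 0 (hit Nplus v) + (position h (par c)).elim 0 (threat Nplus d v)

theorem load_le {Nplus : V → Finset V} {par : W → W} {d : ℕ} {κ : ℝ} (hκ : 0 ≤ κ) (v : V)
    (h : History W V) (c : W) :
    load Nplus par d κ v h c ≤ touchAt Nplus par d v h c + κ := by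
  unfold load touchAt
  cases position h c <;> cases position h (par c) <;> simp only [Option.elim] <;>
  linarith [hit_nonneg Nplus v ‹_›, threat_nonneg Nplus d v ‹_›]

theorem elim_hit_le_load {Nplus : V → Finset V} {par : W → W} {d : ℕ} {κ : ℝ} (hκ : 0 ≤ κ) (v : V)
    (h : History W V) (c : W) :
    (position h c).elim 0 (hit Nplus v) ≤ load Nplus par d κ v h c := by
  unfold load
  cases position h c <;> cases position h (par c) <;> simp only [Option.elim] <;>
  first | exact threat_nonneg Nplus d v _ | exact le_rfl | exact hκ

variable [Fintype W]

/-- An upper estimate for the number of vertices of `Nplus v` that will be occupied eventually,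
including a reserve for the possibility that `v` itself becomes occupied. -/
noncomputable def exposure (Nplus : V → Finset V) (par : W → W) (d : ℕ) (κ : ℝ) (v : V)
    (h : History W V) : ℝ :=
  ∑ c, load Nplus par d κ v h c + if Occupied h v then 0 else (d : ℝ) / 64

/-- The total effect of the placements made so far on the out-neighbourhood of `v`. -/
noncomputable def touch (Nplus : V → Finset V) (par : W → W) (d : ℕ) (v : V)
    (h : History W V) : ℝ :=
  ∑ c, touchAt Nplus par d v h c

theorem exposure_le {Nplus : V → Finset V} {par : W → W} {d : ℕ} {κ : ℝ} (hκ : 0 ≤ κ) (v : V)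
    (h : History W V) :
    exposure Nplus par d κ v h ≤ touch Nplus par d v h + κ * Fintype.card W + d / 64 := by
  have h1 : ∑ c, load Nplus par d κ v h c ≤ ∑ c, (touchAt Nplus par d v h c + κ) :=
    Finset.sum_le_sum fun c _ => load_le hκ v h c
  rw [Finset.sum_add_distrib, Finset.sum_const, nsmul_eq_mul, Finset.card_univ] at h1
  have h2 : (if Occupied h v then 0 else (d : ℝ) / 64) ≤ d / 64 := by
    split_ifs
    · positivity
    · exact le_rfl
  unfold exposure touch
  linarith

theorem touch_le_touch_cons {Nplus : V → Finset V} {par : W → W} {d : ℕ} {v : V}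
    {h : History W V} {c : W} {x : V} (hc : position h c = none) :
    touch Nplus par d v h ≤ touch Nplus par d v ((c, x) :: h) := by
  have aux : ∀ (f : V → ℝ), (∀ z, 0 ≤ f z) → ∀ u,
      (position h u).elim 0 f ≤ (position ((c, x) :: h) u).elim 0 f := by
    intro f hf u
    by_cases hu : u = c
    · subst hu
      rw [hc, position_cons_self]
      exact hf x
    · rw [position_cons_of_ne hu]
  exact Finset.sum_le_sum fun u _ =>
    add_le_add (aux _ (hit_nonneg Nplus v) _) (aux _ (threat_nonneg Nplus d v) _)

/-- Only the loads of `c` and of its children change, together with the reserve when `x = v`. -/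
theorem exposure_cons {Nplus : V → Finset V} {par : W → W} {d : ℕ} {κ : ℝ} {v : V}
    {h : History W V} {c : W} {x y : V} (hc : position h c = none)
    (hy : position h (par c) = some y) (hkids : ∀ w, par w = c → position h w = none)
    (hx : ¬ Occupied h x) :
    exposure Nplus par d κ v ((c, x) :: h) = exposure Nplus par d κ v h + hit Nplus v x
      - threat Nplus d v y + (Finset.univ.filter fun w => par w = c).card *
        (threat Nplus d v x - κ) - if x = v then (d : ℝ) / 64 else 0 := by
  have hpc : par c ≠ c := by
    intro h'
    rw [h', hc] at hy
    simp at hy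
  have h1 : ∀ w, load Nplus par d κ v ((c, x) :: h) w = load Nplus par d κ v h w +
      (if w = c then hit Nplus v x - threat Nplus d v y else 0) +
      (if par w = c then threat Nplus d v x - κ else 0) := by
    intro w
    unfold load
    by_cases hw : w = c
    · subst hw
      rw [position_cons_self, hc, hy, if_pos rfl, if_neg hpc]
      simp
    · rw [position_cons_of_ne hw, if_neg hw]
      by_cases hpw : par w = c
      · rw [hpw, position_cons_self, hkids w hpw, hc, if_pos rfl]
        simp
      · rw [position_cons_of_ne hpw, if_neg hpw]
        simp
  have h2 : (if Occupied ((c, x) :: h) v then 0 else (d : ℝ) / 64) =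
      (if Occupied h v then 0 else (d : ℝ) / 64) - if x = v then (d : ℝ) / 64 else 0 := by
    rw [occupied_cons]
    by_cases hxv : x = v
    · subst hxv
      simp [hx]
    · simp [hxv, Ne.symm hxv]
  unfold exposure
  rw [h2, Finset.sum_congr rfl fun w _ => h1 w, Finset.sum_add_distrib, Finset.sum_add_distrib,
    Finset.sum_ite_eq' Finset.univ c, if_pos (Finset.mem_univ c), ← Finset.sum_filter,
    Finset.sum_const, nsmul_eq_mul]
  ring

/-- The quantitative hypotheses under which the algorithm is analysed. -/
structure Controlled (Nplus : V → Finset V) (r : W) (par : W → W) (d : ℕ) (θ κ N : ℝ) :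
    Prop where
  card : ∀ v, (Nplus v).card = d
  large : 256 ≤ d
  θ_nonneg : 0 ≤ θ
  κ_nonneg : 0 ≤ κ
  root : par r = r
  degree : ∀ u, ((Finset.univ.filter fun w => w ≠ r ∧ par w = u).card : ℝ) ≤ d / 256
  average : ∀ (y v : V) (A : Finset V) (c : ℝ), A ⊆ Nplus y → (d : ℝ) ≤ 2 * A.card →
    0 ≤ c → c ≤ d / 256 →
    ∑ x ∈ A, Real.exp (θ * hit Nplus v x + 4 * θ * c * relOverlap Nplus d v x) ≤
      A.card * Real.exp (θ * threat Nplus d v y + θ * c * κ)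
  heavy : ∀ h : History W V, Valid Nplus r par h → ∀ F : Finset V,
    (∀ v ∈ F, (d : ℝ) / 16 ≤ touch Nplus par d v h) → (F.card : ℝ) ≤ N
  size : κ * Fintype.card W ≤ 69 / 256 * d

/-- The vertices whose out-neighbourhoods are considerably affected by the placements so far. -/
noncomputable def heavySet (Nplus : V → Finset V) (par : W → W) (d : ℕ) (h : History W V) :
    Finset V :=
  if hf : {v | (d : ℝ) / 16 ≤ touch Nplus par d v h}.Finite then hf.toFinset else ∅

/-- The value of the exponential of the exposure that is never exceeded when a vertex becomes
heavy. -/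
noncomputable def entryLevel (d : ℕ) (θ : ℝ) : ℝ := Real.exp (θ * (94 / 256 * d))

/-- A supermartingale that controls all out-neighbourhoods at once. -/
noncomputable def potential (Nplus : V → Finset V) (par : W → W) (d : ℕ) (θ κ N : ℝ)
    (h : History W V) : ℝ :=
  N * entryLevel d θ + ∑ v ∈ heavySet Nplus par d h,
    (Real.exp (θ * exposure Nplus par d κ v h) - entryLevel d θ)

section

variable {Nplus : V → Finset V} {r : W} {par : W → W} {d : ℕ} {θ κ N : ℝ} {h : History W V}

theorem Controlled.mem_heavySet (H : Controlled Nplus r par d θ κ N) (hv : Valid Nplus r par h)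
    (v : V) : v ∈ heavySet Nplus par d h ↔ (d : ℝ) / 16 ≤ touch Nplus par d v h := by
  have hf : {v | (d : ℝ) / 16 ≤ touch Nplus par d v h}.Finite := by
    by_contra hinf
    -- `V` may be infinite: more than `N` heavy vertices would already contradict the bound on
    -- finite heavy sets.
    obtain ⟨F, hF, hc⟩ := Set.Infinite.exists_subset_card_eq hinf (⌊N⌋₊ + 1)
    have h1 := H.heavy h hv F fun v hvF => hF hvF
    rw [hc] at h1
    have := Nat.lt_floor_add_one N
    push_cast at h1
    linarith
  unfold heavySet
  rw [dif_pos hf]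
  simp

theorem Controlled.card_heavySet_le (H : Controlled Nplus r par d θ κ N)
    (hv : Valid Nplus r par h) : ((heavySet Nplus par d h).card : ℝ) ≤ N :=
  H.heavy h hv _ fun v hvF => (H.mem_heavySet hv v).1 hvF

theorem entryLevel_pos (d : ℕ) (θ : ℝ) : 0 < entryLevel d θ := Real.exp_pos _

/-- There are at most `N` heavy vertices, so the term `N * entryLevel d θ` covers every subtracted
entry level. -/
theorem Controlled.le_potential (H : Controlled Nplus r par d θ κ N)
    (hv : Valid Nplus r par h) {v : V} (hvh : v ∈ heavySet Nplus par d h) :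
    Real.exp (θ * exposure Nplus par d κ v h) ≤ potential Nplus par d θ κ N h := by
  unfold potential
  rw [Finset.sum_sub_distrib, Finset.sum_const, nsmul_eq_mul]
  have h1 := Finset.single_le_sum (f := fun v => Real.exp (θ * exposure Nplus par d κ v h))
    (fun v _ => (Real.exp_pos _).le) hvh
  have h2 := mul_le_mul_of_nonneg_right (H.card_heavySet_le hv) (entryLevel_pos d θ).le
  linarith

theorem Controlled.potential_nonneg (H : Controlled Nplus r par d θ κ N)
    (hv : Valid Nplus r par h) : 0 ≤ potential Nplus par d θ κ N h := by
  unfold potential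
  rw [Finset.sum_sub_distrib, Finset.sum_const, nsmul_eq_mul]
  have h1 : 0 ≤ ∑ v ∈ heavySet Nplus par d h, Real.exp (θ * exposure Nplus par d κ v h) :=
    Finset.sum_nonneg fun v _ => (Real.exp_pos _).le
  have h2 := mul_le_mul_of_nonneg_right (H.card_heavySet_le hv) (entryLevel_pos d θ).le
  linarith

theorem Controlled.card_children_le (H : Controlled Nplus r par d θ κ N) {c : W} (hc : c ≠ r) :
    ((Finset.univ.filter fun w => par w = c).card : ℝ) ≤ d / 256 := by
  convert H.degree c using 4 with w
  refine ⟨fun hw => ⟨?_, hw⟩, fun hw => hw.2⟩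
  rintro rfl
  exact hc (hw.symm.trans H.root)

theorem Controlled.d_pos (H : Controlled Nplus r par d θ κ N) : (0 : ℝ) < d := by
  have := H.large
  exact_mod_cast (by omega : 0 < d)

/-- For `x = v` the threat to each child may be as large as `4`, but there are at most `d / 256`
children, so the released reserve `d / 64` pays for them all. This is why `relOverlap` may vanish at
`v`. -/
theorem Controlled.exposure_cons_le (H : Controlled Nplus r par d θ κ N) {v : V} {c : W} {x y : V}
    (hcr : c ≠ r) (hc : position h c = none)
    (hy : position h (par c) = some y) (hkids : ∀ w, par w = c → position h w = none)
    (hx : ¬ Occupied h x) :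
    exposure Nplus par d κ v ((c, x) :: h) ≤ exposure Nplus par d κ v h - threat Nplus d v y -
      (Finset.univ.filter fun w => par w = c).card * κ + hit Nplus v x +
      4 * (Finset.univ.filter fun w => par w = c).card * relOverlap Nplus d v x := by
  rw [exposure_cons hc hy hkids hx]
  have hn := H.card_children_le hcr
  set n : ℝ := ((Finset.univ.filter fun w => par w = c).card : ℝ)
  have hn0 : 0 ≤ n := by positivity
  unfold relOverlap
  by_cases hxv : x = v
  · rw [if_pos hxv, if_pos hxv]
    have := threat_le H.card v x
    nlinarith
  · rw [if_neg hxv, if_neg hxv]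
    unfold threat
    linarith

theorem Controlled.sum_exp_exposure_cons_le (H : Controlled Nplus r par d θ κ N) (v : V)
    {c : W} {y : V} (hcr : c ≠ r) (hc : position h c = none)
    (hy : position h (par c) = some y) (hkids : ∀ w, par w = c → position h w = none)
    (hA : (d : ℝ) ≤ 2 * (available (Nplus y) h).card) :
    ∑ x ∈ available (Nplus y) h, Real.exp (θ * exposure Nplus par d κ v ((c, x) :: h)) ≤
      (available (Nplus y) h).card * Real.exp (θ * exposure Nplus par d κ v h) := by
  set n : ℝ := ((Finset.univ.filter fun w => par w = c).card : ℝ) with hn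
  set A := available (Nplus y) h with hAdef
  have havg := H.average y v A n (Finset.filter_subset _ _) hA (by positivity)
    (H.card_children_le hcr)
  calc _ ≤ ∑ x ∈ A, Real.exp (θ * (exposure Nplus par d κ v h - threat Nplus d v y - n * κ)) *
        Real.exp (θ * hit Nplus v x + 4 * θ * n * relOverlap Nplus d v x) := by
        refine Finset.sum_le_sum fun x hx => ?_
        rw [← Real.exp_add, Real.exp_le_exp]
        have := mul_le_mul_of_nonneg_left (H.exposure_cons_le (v := v) hcr hc hy hkids
          (Finset.mem_filter.1 hx).2) H.θ_nonneg
        rw [← hn] at this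
        linarith
    _ ≤ Real.exp (θ * (exposure Nplus par d κ v h - threat Nplus d v y - n * κ)) *
        (A.card * Real.exp (θ * threat Nplus d v y + θ * n * κ)) := by
        rw [← Finset.mul_sum]
        gcongr
    _ = _ := by
        rw [mul_left_comm, ← Real.exp_add]
        congr 3
        ring

/-- In units of `d / 256`: touch `16`, the terms `κ` in total `69`, reserve `4`, the new hit `1`,
new threats `4`; the sum is `94`. -/
theorem Controlled.exposure_cons_le_of_light (H : Controlled Nplus r par d θ κ N) {v : V} {c : W}
    {x y : V} (hcr : c ≠ r) (hc : position h c = none)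
    (hy : position h (par c) = some y) (hkids : ∀ w, par w = c → position h w = none)
    (hx : ¬ Occupied h x) (hlight : touch Nplus par d v h ≤ d / 16) :
    exposure Nplus par d κ v ((c, x) :: h) ≤ 94 / 256 * d := by
  have h1 := H.exposure_cons_le (v := v) hcr hc hy hkids hx
  have h2 := exposure_le H.κ_nonneg (Nplus := Nplus) (par := par) (d := d) v h
  have h3 := H.size
  have h4 := hit_le_one Nplus v x
  have h5 := threat_nonneg Nplus d v y
  have h6 := relOverlap_le_one H.card v x
  have h7 := relOverlap_nonneg Nplus d v x
  have hn := H.card_children_le hcr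
  set n : ℝ := ((Finset.univ.filter fun w => par w = c).card : ℝ)
  have hn0 : 0 ≤ n := by positivity
  have h8 : 0 ≤ n * κ := mul_nonneg hn0 H.κ_nonneg
  have h9 : 4 * n * relOverlap Nplus d v x ≤ 4 * n := mul_le_of_le_one_right (by positivity) h6
  have h10 : (256 : ℝ) ≤ d := by exact_mod_cast H.large
  linarith

/-- Heaviness is never lost because `touch` is monotone, and newly heavy vertices were light before
the step, so their exposure is at most the entry level and their terms are nonpositive. The sum can
therefore run over the old heavy set, which does not depend on `x`. -/
theorem Controlled.potential_cons_le (H : Controlled Nplus r par d θ κ N)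
    (hv : Valid Nplus r par h) {c : W} {x y : V} (hcr : c ≠ r) (hc : position h c = none)
    (hy : position h (par c) = some y) (hkids : ∀ w, par w = c → position h w = none)
    (hx : x ∈ available (Nplus y) h) :
    potential Nplus par d θ κ N ((c, x) :: h) ≤ N * entryLevel d θ +
      ∑ v ∈ heavySet Nplus par d h,
        (Real.exp (θ * exposure Nplus par d κ v ((c, x) :: h)) - entryLevel d θ) := by
  have hv' := hv.cons hc hy hx
  have hsub : heavySet Nplus par d h ⊆ heavySet Nplus par d ((c, x) :: h) := by
    intro v hvh
    rw [H.mem_heavySet hv] at hvh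
    rw [H.mem_heavySet hv']
    exact hvh.trans (touch_le_touch_cons hc)
  unfold potential
  rw [← Finset.sum_sdiff hsub]
  have : ∑ v ∈ heavySet Nplus par d ((c, x) :: h) \ heavySet Nplus par d h,
      (Real.exp (θ * exposure Nplus par d κ v ((c, x) :: h)) - entryLevel d θ) ≤ 0 := by
    refine Finset.sum_nonpos fun v hvD => ?_
    have hl := (Finset.mem_sdiff.1 hvD).2
    rw [H.mem_heavySet hv, not_le] at hl
    rw [sub_nonpos]
    unfold entryLevel
    rw [Real.exp_le_exp]
    exact mul_le_mul_of_nonneg_left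
      (H.exposure_cons_le_of_light hcr hc hy hkids (Finset.mem_filter.1 hx).2 hl.le) H.θ_nonneg
  linarith

theorem Controlled.sum_potential_cons_le (H : Controlled Nplus r par d θ κ N)
    (hv : Valid Nplus r par h) {c : W} {y : V} (hcr : c ≠ r) (hc : position h c = none)
    (hy : position h (par c) = some y) (hkids : ∀ w, par w = c → position h w = none)
    (hA : (d : ℝ) ≤ 2 * (available (Nplus y) h).card) :
    ∑ x ∈ available (Nplus y) h, potential Nplus par d θ κ N ((c, x) :: h) ≤
      (available (Nplus y) h).card * potential Nplus par d θ κ N h := by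
  set A := available (Nplus y) h with hAdef
  calc _ ≤ ∑ x ∈ A, (N * entryLevel d θ + ∑ v ∈ heavySet Nplus par d h,
        (Real.exp (θ * exposure Nplus par d κ v ((c, x) :: h)) - entryLevel d θ)) :=
        Finset.sum_le_sum fun x hx => H.potential_cons_le hv hcr hc hy hkids hx
    _ = A.card * (N * entryLevel d θ) + ∑ v ∈ heavySet Nplus par d h,
        (∑ x ∈ A, Real.exp (θ * exposure Nplus par d κ v ((c, x) :: h)) -
          A.card * entryLevel d θ) := by
        rw [Finset.sum_add_distrib, Finset.sum_comm, Finset.sum_const, nsmul_eq_mul]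
        simp only [Finset.sum_sub_distrib, Finset.sum_const, nsmul_eq_mul]
    _ ≤ A.card * (N * entryLevel d θ) + ∑ v ∈ heavySet Nplus par d h,
        (A.card * Real.exp (θ * exposure Nplus par d κ v h) - A.card * entryLevel d θ) := by
        gcongr with v
        exact H.sum_exp_exposure_cons_le v hcr hc hy hkids hA
    _ = _ := by
        unfold potential
        simp only [← mul_sub, ← Finset.mul_sum, mul_add]

end

end Potential

/-! ### Following a run of the algorithm -/

section Run

open Classical

theorem toOuterMeasure_le_one {α : Type*} (p : PMF α) (s : Set α) : p.toOuterMeasure s ≤ 1 :=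
  (p.toOuterMeasure.mono (Set.subset_univ s)).trans
    ((p.toOuterMeasure_apply_eq_one_iff Set.univ).2 (Set.subset_univ _)).le

theorem toOuterMeasure_uniform_bind_le {α β : Type*} {A : Finset α} (hA : A.Nonempty)
    (f : α → PMF β) (s : Set β) {B : α → ℝ} {b : ℝ} (hB : ∀ x ∈ A, 0 ≤ B x)
    (hf : ∀ x ∈ A, (f x).toOuterMeasure s ≤ ENNReal.ofReal (B x))
    (hsum : ∑ x ∈ A, B x ≤ A.card * b) :
    ((PMF.uniformOfFinset A hA).bind f).toOuterMeasure s ≤ ENNReal.ofReal b := by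
  rw [PMF.toOuterMeasure_bind_apply, tsum_eq_sum (s := A)]
  · calc _ ≤ ∑ x ∈ A, (A.card : ENNReal)⁻¹ * ENNReal.ofReal (B x) := by
          refine Finset.sum_le_sum fun x hx => ?_
          rw [PMF.uniformOfFinset_apply_of_mem hA hx]
          exact mul_le_mul_right (hf x hx) _
      _ = (A.card : ENNReal)⁻¹ * ENNReal.ofReal (∑ x ∈ A, B x) := by
          rw [← Finset.mul_sum, ENNReal.ofReal_sum_of_nonneg hB]
      _ ≤ (A.card : ENNReal)⁻¹ * ENNReal.ofReal (A.card * b) := by gcongr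
      _ = ENNReal.ofReal b := by
          have h0 : (A.card : ENNReal) ≠ 0 := by
            simpa using hA.ne_empty
          rw [ENNReal.ofReal_mul (by positivity), ENNReal.ofReal_natCast, ← mul_assoc,
            ENNReal.inv_mul_cancel h0 (ENNReal.natCast_ne_top _), one_mul]
  · intro x hx
    rw [PMF.uniformOfFinset_apply_of_notMem hA hx, zero_mul]

variable {V W : Type*}

theorem mem_foundEmbedding {G : SimpleGraph V} {T : SimpleGraph W} {Nplus : V → Finset V} {r : W}
    {par : W → W} (hpar : IsParentMap T r par) (hN : ∀ v, (Nplus v : Set V) ⊆ G.neighborSet v)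
    {h : History W V} (hv : Valid Nplus r par h) (hall : ∀ u, Embedded h u) :
    some h ∈ foundEmbedding T G := by
  have hex : ∀ u, ∃ x, position h u = some x := fun u =>
    Option.ne_none_iff_exists'.1 ((hv.embedded_iff u).1 (hall u))
  choose f hf using hex
  have hedge : ∀ w, w ≠ r → G.Adj (f (par w)) (f w) := by
    intro w hw
    obtain ⟨y, hy, hxy⟩ := hv.edge w (f w) hw (hf w)
    rw [hf] at hy
    cases hy
    exact hN _ (by simpa using hxy)
  refine ⟨h, rfl, ⟨⟨f, ?_⟩, ?_⟩, ?_⟩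
  · intro a b hab
    rcases hpar.eq_or_eq a b hab with ⟨hb, rfl⟩ | ⟨ha, rfl⟩
    · exact hedge b hb
    · exact (hedge a ha).symm
  · intro a b hab
    refine hv.inj a b (f a) (hf a) ?_
    rw [show f a = f b from hab]
    exact hf b
  · intro u x
    rw [hv.mem_iff, hf]
    exact Option.some_inj

variable [Fintype W]

/-- The tree vertices that are already embedded. -/
noncomputable def placed (h : History W V) : Finset W :=
  Finset.univ.filter fun u => position h u ≠ none

theorem card_placed_cons {h : History W V} {c : W} (x : V) (hc : position h c = none) :
    (placed ((c, x) :: h)).card = (placed h).card + 1 := by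
  have : placed ((c, x) :: h) = insert c (placed h) := by
    ext u
    simp only [placed, Finset.mem_filter, Finset.mem_univ, true_and, Finset.mem_insert,
      position_cons]
    by_cases hu : u = c
    · simp [hu]
    · simp [hu]
  rw [this, Finset.card_insert_of_notMem (by simp [placed, hc])]

/-- The state of a run in the middle of a round: the children `cs` of the tree vertex `u`, which
is placed at `y`, are still to be placed. -/
structure Placing (Nplus : V → Finset V) (r : W) (par : W → W) (d : ℕ) (u : W) (y : V) (m : ℕ)
    (cs : List W) (h : History W V) : Prop where
  valid : Valid Nplus r par h
  pos : position h u = some y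
  nodup : cs.Nodup
  fresh : ∀ c ∈ cs, c ≠ r ∧ par c = u ∧ position h c = none
  done : ∀ w, w ≠ r → par w = u → w ∉ cs → position h w ≠ none
  closed : ∀ w w', w ≠ r → w' ≠ r → par w = par w' → par w ≠ u → position h w ≠ none →
    position h w' ≠ none
  room : d + 2 * cs.length ≤ 2 * (available (Nplus y) h).card
  count : m ≤ (placed h).card + cs.length

theorem Placing.cons {Nplus : V → Finset V} {r : W} {par : W → W} {d : ℕ} {u : W} {y : V} {m : ℕ}
    {c : W} {cs : List W} {h : History W V} (hp : Placing Nplus r par d u y m (c :: cs) h) {x : V}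
    (hx : x ∈ available (Nplus y) h) : Placing Nplus r par d u y m cs ((c, x) :: h) := by
  obtain ⟨hcr, hcu, hc⟩ := hp.fresh c (by simp)
  have hne : ∀ w, position h w ≠ none → position ((c, x) :: h) w ≠ none := by
    intro w hw
    rw [position_cons]
    split_ifs
    · simp
    · exact hw
  have huc : u ≠ c := by
    rintro rfl
    rw [hp.pos] at hc
    simp at hc
  refine ⟨hp.valid.cons hc (by rw [hcu]; exact hp.pos) hx, ?_, hp.nodup.of_cons, ?_, ?_, ?_, ?_, ?_⟩
  · rw [position_cons_of_ne huc]; exact hp.pos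
  · intro c' hc'
    have hcc : c' ≠ c := by
      rintro rfl
      exact (List.nodup_cons.1 hp.nodup).1 hc'
    rw [position_cons_of_ne hcc]
    exact hp.fresh c' (List.mem_cons_of_mem _ hc')
  · intro w hw hwu hwcs
    by_cases hwc : w = c
    · subst hwc
      rw [position_cons_self]; simp
    · exact hne w (hp.done w hw hwu (by simp [hwc, hwcs]))
  · intro w w' hw hw' hww hwu hwp
    have hwc : w ≠ c := by
      rintro rfl
      exact hwu hcu
    rw [position_cons_of_ne hwc] at hwp
    exact hne w' (hp.closed w w' hw hw' hww hwu hwp)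
  · have hsub : (available (Nplus y) h).erase x ⊆ available (Nplus y) ((c, x) :: h) := by
      intro z hz
      rw [Finset.mem_erase] at hz
      have hz2 := Finset.mem_filter.1 hz.2
      refine Finset.mem_filter.2 ⟨hz2.1, ?_⟩
      rw [occupied_cons]
      exact fun hh => hh.elim hz.1 hz2.2
    have h1 := Finset.card_le_card hsub
    have h2 := Finset.card_erase_add_one hx
    have h3 := hp.room
    rw [List.length_cons] at h3
    omega
  · have h1 := card_placed_cons x hc
    have h2 := hp.count
    rw [List.length_cons] at h2
    omega

/-- The continuation `K` is the rest of the run. A failure bound proportional to the potential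
passes backwards through each random placement, by the supermartingale inequality. -/
theorem Controlled.placeAll_bind_le {Nplus : V → Finset V} {r : W} {par : W → W} {d : ℕ}
    {θ κ N : ℝ} (H : Controlled Nplus r par d θ κ N) {u : W} {y : V} {m : ℕ} {β : Type*}
    (K : Option (History W V) → PMF β) (s : Set β) {lam : ℝ} (hlam : 0 < lam)
    (hK : ∀ h, Placing Nplus r par d u y m [] h →
      (K (some h)).toOuterMeasure s ≤ ENNReal.ofReal (potential Nplus par d θ κ N h / lam))
    (cs : List W) : ∀ h, Placing Nplus r par d u y m cs h →
      ((placeAll (Nplus y) cs h).bind K).toOuterMeasure s ≤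
        ENNReal.ofReal (potential Nplus par d θ κ N h / lam) := by
  induction cs with
  | nil =>
    intro h hp
    rw [placeAll, PMF.pure_bind]
    exact hK h hp
  | cons c cs ih =>
    intro h hp
    have hroom := hp.room
    rw [List.length_cons] at hroom
    have hne : (available (Nplus y) h).Nonempty := by
      rw [← Finset.card_pos]; omega
    obtain ⟨hcr, hcu, hc⟩ := hp.fresh c (by simp)
    have hy : position h (par c) = some y := by rw [hcu]; exact hp.pos
    rw [placeAll, dif_pos hne, PMF.bind_bind]
    refine toOuterMeasure_uniform_bind_le hne _ _
      (B := fun x => potential Nplus par d θ κ N ((c, x) :: h) / lam) ?_ ?_ ?_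
    · intro x hx
      exact div_nonneg (H.potential_nonneg (hp.cons hx).valid) hlam.le
    · intro x hx
      exact ih _ (hp.cons hx)
    · rw [← Finset.sum_div, ← mul_div_assoc]
      refine div_le_div_of_nonneg_right ?_ hlam.le
      refine H.sum_potential_cons_le hp.valid hcr hc hy ?_ ?_
      -- Valid histories are closed under parents, so an unplaced `c` has no placed child.
      · intro w hw
        by_contra hwp
        obtain ⟨z, hz⟩ := Option.ne_none_iff_exists'.1 hwp
        have hwr : w ≠ r := by
          rintro rfl
          exact hcr (hw.symm.trans H.root)
        obtain ⟨y', hy', -⟩ := hp.valid.edge w z hwr hz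
        rw [hw, hc] at hy'
        simp at hy'
      · exact_mod_cast (by omega : d ≤ 2 * (available (Nplus y) h).card)

theorem Valid.card_occupied_le {Nplus : V → Finset V} {r : W} {par : W → W} {h : History W V}
    (hv : Valid Nplus r par h) (v : V) :
    ((Nplus v).card : ℝ) - (available (Nplus v) h).card ≤
      ∑ c, (position h c).elim 0 (hit Nplus v) := by
  have h1 : (Nplus v).card = (available (Nplus v) h).card +
      ((Nplus v).filter fun x => Occupied h x).card := by
    rw [add_comm, available, Finset.card_filter_add_card_filter_not]
  have h2 : (((Nplus v).filter fun x => Occupied h x).card : ℝ) ≤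
      ∑ c, (position h c).elim 0 (hit Nplus v) := by
    have hsub : (Nplus v).filter (fun x => Occupied h x) ⊆
        (Finset.univ.filter fun c => ∃ x ∈ Nplus v, position h c = some x).image
          fun c => (position h c).getD v := by
      intro x hx
      rw [Finset.mem_filter, hv.occupied_iff] at hx
      obtain ⟨hxv, c, hc⟩ := hx
      rw [Finset.mem_image]
      exact ⟨c, by simpa using ⟨x, hxv, hc⟩, by rw [hc]; rfl⟩
    have h3 := (Finset.card_le_card hsub).trans Finset.card_image_le
    refine le_trans (Nat.cast_le.2 h3) ?_
    rw [Finset.card_filter]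
    push_cast
    refine Finset.sum_le_sum fun c _ => ?_
    split_ifs with hc
    · obtain ⟨x, hxv, hc⟩ := hc
      rw [hc]
      simp [hit, hxv]
    · cases position h c with
      | none => simp
      | some z => exact hit_nonneg _ _ _
  have h4 : ((Nplus v).card : ℝ) = (available (Nplus v) h).card +
      ((Nplus v).filter fun x => Occupied h x).card := by exact_mod_cast h1
  linarith

/-- If few vertices of `Nplus v` are available, then the potential is large. -/
theorem Controlled.exp_le_potential {Nplus : V → Finset V} {r : W} {par : W → W} {d : ℕ}
    {θ κ N : ℝ} (H : Controlled Nplus r par d θ κ N) {h : History W V}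
    (hv : Valid Nplus r par h) {v : V}
    (hfew : (available (Nplus v) h).card ≤ (129 / 256 : ℝ) * d) :
    Real.exp (θ * (127 / 256 * d)) ≤ potential Nplus par d θ κ N h := by
  have h1 := hv.card_occupied_le v
  rw [H.card] at h1
  have hd := H.d_pos
  refine le_trans ?_ (H.le_potential hv (v := v) ?_)
  · rw [Real.exp_le_exp]
    refine mul_le_mul_of_nonneg_left ?_ H.θ_nonneg
    have h2 : ∑ c, (position h c).elim 0 (hit Nplus v) ≤ ∑ c, load Nplus par d κ v h c :=
      Finset.sum_le_sum fun c _ => elim_hit_le_load H.κ_nonneg v h c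
    have h3 : (0 : ℝ) ≤ if Occupied h v then 0 else (d : ℝ) / 64 := by
      split_ifs <;> positivity
    unfold exposure
    linarith
  -- The `127/256 * d` hits alone exceed the threshold `d / 16`.
  · rw [H.mem_heavySet hv]
    have h2 : ∑ c, (position h c).elim 0 (hit Nplus v) ≤ touch Nplus par d v h := by
      refine Finset.sum_le_sum fun c _ => ?_
      unfold touchAt
      have : 0 ≤ (position h (par c)).elim 0 (threat Nplus d v) := by
        cases position h (par c) with
        | none => simp
        | some z => exact threat_nonneg _ _ _ _
      linarith
    linarith

/-- An unembedded vertex closest to the root has an embedded parent; since siblings are embedded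
together, no child of that parent is embedded. -/
theorem exists_ready {T : SimpleGraph W} {Nplus : V → Finset V} {r : W}
    {par : W → W} (hpar : IsParentMap T r par) {h : History W V} (hv : Valid Nplus r par h)
    (hclosed : ∀ w w', w ≠ r → w' ≠ r → par w = par w' → position h w ≠ none →
      position h w' ≠ none) (hall : ¬ ∀ u, Embedded h u) : ∃ u, Ready T r h u := by
  push Not at hall
  obtain ⟨w, hw, hmin⟩ := Finset.exists_min_image (Finset.univ.filter fun u => ¬ Embedded h u)
    (fun u => T.dist r u) (by
      obtain ⟨u, hu⟩ := hall
      exact ⟨u, by simpa using hu⟩)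
  have hw' : ¬ Embedded h w := by simpa using hw
  have hwr : w ≠ r := by
    rintro rfl
    exact hw' ((hv.embedded_iff w).2 hv.root)
  refine ⟨par w, ?_, ⟨w, (hpar.isChild_iff _ _).2 ⟨hwr, rfl⟩⟩, ?_⟩
  · by_contra hp
    have := hmin (par w) (by simpa using hp)
    exact absurd (hpar.dist_lt w hwr) (by omega)
  · intro w' hc' he'
    rw [hpar.isChild_iff] at hc'
    rw [hv.embedded_iff] at he' hw'
    exact hw' (hclosed w' w hc'.1 hwr hc'.2 he')

/-- Markov's inequality in recursive form: the bound is at least `1` in dangerous states, and is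
inherited from later states otherwise. -/
theorem Controlled.rounds_le {G : SimpleGraph V} {T : SimpleGraph W} {Nplus : V → Finset V} {r : W}
    {par : W → W} {d : ℕ} {θ κ N : ℝ} (H : Controlled Nplus r par d θ κ N)
    (hpar : IsParentMap T r par) (hN : ∀ v, (Nplus v : Set V) ⊆ G.neighborSet v)
    (σ : Schedule T r V) (n : ℕ) : ∀ h : History W V, Valid Nplus r par h →
      (∀ w w', w ≠ r → w' ≠ r → par w = par w' → position h w ≠ none → position h w' ≠ none) →
      Fintype.card W ≤ (placed h).card + n →
      (rounds Nplus σ n h).toOuterMeasure (foundEmbedding T G)ᶜ ≤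
        ENNReal.ofReal (potential Nplus par d θ κ N h / Real.exp (θ * (127 / 256 * d))) := by
  have hdone : ∀ h : History W V, Valid Nplus r par h → (∀ u, Embedded h u) →
      (PMF.pure (some h)).toOuterMeasure (foundEmbedding T G)ᶜ = 0 := by
    intro h hv hall
    rw [PMF.toOuterMeasure_pure_apply, if_neg]
    exact fun hn => hn (mem_foundEmbedding hpar hN hv hall)
  induction n with
  | zero =>
    intro h hv _ hcount
    have hall : ∀ u, Embedded h u := by
      intro u
      rw [hv.embedded_iff]
      have : placed h = Finset.univ := Finset.eq_univ_of_card _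
        (le_antisymm (Finset.card_le_univ _) hcount)
      have hu : u ∈ placed h := this ▸ Finset.mem_univ u
      simpa [placed] using hu
    rw [rounds, if_pos hall, hdone h hv hall]
    exact zero_le
  | succ n ih =>
    intro h hv hclosed hcount
    by_cases hall : ∀ u, Embedded h u
    · rw [rounds, if_pos hall, hdone h hv hall]
      exact zero_le
    have hready := σ.pick_ready h (exists_ready hpar hv hclosed hall)
    have hemb := hready.1
    rw [hv.embedded_iff] at hemb
    obtain ⟨y, hy⟩ := Option.ne_none_iff_exists'.1 hemb
    have horder : ∀ w, w ∈ σ.order h ↔ w ≠ r ∧ par w = σ.pick h := by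
      intro w
      rw [σ.mem_order, hpar.isChild_iff]
    have hlen : ((σ.order h).length : ℝ) ≤ d / 256 := by
      refine le_trans (Nat.cast_le.2 ?_) (H.degree (σ.pick h))
      rw [← List.toFinset_card_of_nodup (σ.order_nodup h)]
      refine Finset.card_le_card fun w hw => ?_
      rw [List.mem_toFinset, horder] at hw
      simpa using hw
    have hpos : 1 ≤ (σ.order h).length := by
      obtain ⟨w, hw⟩ := hready.2.1
      exact List.length_pos_of_mem ((σ.mem_order h w).2 hw)
    by_cases hfew : (available (Nplus y) h).card ≤ (129 / 256 : ℝ) * d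
    · refine (toOuterMeasure_le_one _ _).trans ?_
      rw [ENNReal.one_le_ofReal, one_le_div (Real.exp_pos _)]
      exact H.exp_le_potential hv hfew
    -- Availability above `129/256 * d` minus at most `d / 256` children keeps half of `Nplus y`
    -- free throughout the round.
    · have hroom : d + 2 * (σ.order h).length ≤ 2 * (available (Nplus y) h).card := by
        have : (d : ℝ) + 2 * (σ.order h).length ≤ 2 * (available (Nplus y) h).card := by linarith
        exact_mod_cast this
      rw [rounds, if_neg hall, round]
      simp only [hy]
      rw [if_pos (by omega)]
      refine H.placeAll_bind_le (u := σ.pick h) (m := (placed h).card + 1) _ _ (Real.exp_pos _)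
        ?_ _ h ?_
      · intro h' hp
        refine ih h' hp.valid ?_ ?_
        · intro w w' hw hw' hww hwp
          by_cases hwu : par w = σ.pick h
          · exact hp.done w' hw' (hww ▸ hwu) (by simp)
          · exact hp.closed w w' hw hw' hww hwu hwp
        · have := hp.count
          simp only [List.length_nil] at this
          omega
      · refine ⟨hv, hy, σ.order_nodup h, ?_, ?_, ?_, hroom, by omega⟩
        · intro c hc
          obtain ⟨hcr, hcu⟩ := (horder c).1 hc
          have := hready.2.2 c ((hpar.isChild_iff _ _).2 ⟨hcr, hcu⟩)
          rw [hv.embedded_iff, not_not] at this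
          exact ⟨hcr, hcu, this⟩
        · intro w hw hwu hwn
          exact absurd ((horder w).2 ⟨hw, hwu⟩) hwn
        · intro w w' hw hw' hww _ hwp
          exact hclosed w w' hw hw' hww hwp

/-- Initially every exposure is at most `69 + 1 + 4 + 4 = 78` in units of `d / 256`, below the entry
value `94`. -/
theorem Controlled.potential_singleton_le {Nplus : V → Finset V} {r : W}
    {par : W → W} {d : ℕ} {θ κ N : ℝ} (H : Controlled Nplus r par d θ κ N) (x₀ : V) :
    potential Nplus par d θ κ N [(r, x₀)] ≤ N * entryLevel d θ := by
  unfold potential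
  have : ∑ v ∈ heavySet Nplus par d [(r, x₀)],
      (Real.exp (θ * exposure Nplus par d κ v [(r, x₀)]) - entryLevel d θ) ≤ 0 := by
    refine Finset.sum_nonpos fun v _ => ?_
    rw [sub_nonpos]
    unfold entryLevel
    rw [Real.exp_le_exp]
    refine mul_le_mul_of_nonneg_left ?_ H.θ_nonneg
    have hpt : ∀ c, load Nplus par d κ v [(r, x₀)] c ≤
        κ + (if c = r then 1 else 0) + if c ≠ r ∧ par c = r then 4 else 0 := by
      intro c
      unfold load
      rw [position_singleton, position_singleton]
      have h1 := hit_le_one Nplus v x₀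
      have h2 := threat_le H.card v x₀
      have h3 := H.κ_nonneg
      by_cases hc : c = r
      · simp only [hc, if_true, Option.elim, ne_eq, not_true, false_and, if_false]
        linarith
      · by_cases hp : par c = r
        · simp only [hc, hp, if_true, if_false, Option.elim, ne_eq, not_false_eq_true, true_and]
          linarith
        · simp [hc, hp]
    have hsum := Finset.sum_le_sum fun c (_ : c ∈ Finset.univ) => hpt c
    rw [Finset.sum_add_distrib, Finset.sum_add_distrib, Finset.sum_const, nsmul_eq_mul,
      Finset.sum_ite_eq' Finset.univ r, if_pos (Finset.mem_univ r), ← Finset.sum_filter,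
      Finset.sum_const, nsmul_eq_mul, Finset.card_univ] at hsum
    have h1 := H.degree r
    have h2 := H.size
    have h3 : (if Occupied [(r, x₀)] v then 0 else (d : ℝ) / 64) ≤ d / 64 := by
      split_ifs
      · positivity
      · exact le_rfl
    have h4 : (256 : ℝ) ≤ d := by exact_mod_cast H.large
    unfold exposure
    linarith
  linarith

theorem Controlled.embedTree_ge {G : SimpleGraph V} {T : SimpleGraph W} {Nplus : V → Finset V}
    {r : W} {par : W → W} {d : ℕ} {θ κ N ε : ℝ} (H : Controlled Nplus r par d θ κ N)
    (hpar : IsParentMap T r par) (hN : ∀ v, (Nplus v : Set V) ⊆ G.neighborSet v)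
    (σ : Schedule T r V) (x₀ : V) (hε : N * Real.exp (-(θ * (33 / 256 * d))) ≤ ε) :
    1 - ENNReal.ofReal ε ≤
      (embedTree Nplus x₀ σ).toOuterMeasure (foundEmbedding T G) := by
  have hfail : (embedTree Nplus x₀ σ).toOuterMeasure (foundEmbedding T G)ᶜ ≤
      ENNReal.ofReal ε := by
    refine (H.rounds_le hpar hN σ (Fintype.card W) [(r, x₀)] (valid_singleton Nplus r par x₀)
      ?_ (by omega)).trans (ENNReal.ofReal_le_ofReal ?_)
    · intro w w' hw _ _ hwp
      rw [position_singleton, if_neg hw] at hwp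
      exact absurd rfl hwp
    · refine le_trans ?_ hε
      rw [div_le_iff₀ (Real.exp_pos _), mul_assoc, ← Real.exp_add]
      refine (H.potential_singleton_le x₀).trans (le_of_eq ?_)
      unfold entryLevel
      congr 2
      ring
  have htot : (1 : ENNReal) ≤ (embedTree Nplus x₀ σ).toOuterMeasure (foundEmbedding T G) +
      (embedTree Nplus x₀ σ).toOuterMeasure (foundEmbedding T G)ᶜ := by
    refine le_trans ?_ (MeasureTheory.measure_union_le _ _)
    rw [Set.union_compl_self]
    exact ((PMF.toOuterMeasure_apply_eq_one_iff _ Set.univ).2 (Set.subset_univ _)).ge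
  rw [tsub_le_iff_right]
  exact htot.trans (by gcongr)

end Run

/-! ### Few heavy vertices, and the choice of parameters -/

section Heavy

open Classical

variable {V W : Type*} [Fintype W]

/-- `touch` is the total weight of `Nplus v` for a weight on `V` independent of `v`, so the weighted
Kővári–Sós–Turán count applies. -/
theorem card_mul_pow_le_of_touch {G : SimpleGraph V} {s t : ℕ}
    (hfree : (completeBipartiteGraph (Fin s) (Fin t)).Free G) {Nplus : V → Finset V}
    {r : W} {par : W → W} {d : ℕ}
    (hcard : ∀ v, (Nplus v).card = d) (hN : ∀ v, (Nplus v : Set V) ⊆ G.neighborSet v)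
    (hd : 0 < d) {h : History W V} (hv : Valid Nplus r par h) {a : ℝ} (ha : 0 ≤ a)
    (had : a + ((t : ℝ) - 1) * (1 + 4 * Fintype.card W / d) ≤ d / 16) {F : Finset V}
    (hF : ∀ v ∈ F, (d : ℝ) / 16 ≤ touch Nplus par d v h) :
    (F.card : ℝ) * a ^ t ≤ s * (5 * Fintype.card W) ^ t := by
  have hd0 : (0 : ℝ) < d := by exact_mod_cast hd
  -- Each tree vertex gives weight `1` to its own position and spreads weight `4` evenly over the
  -- out-neighbourhood of its parent's position, in total at most `5`.
  set g : V → ℝ := fun b => ∑ c : W,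
    ((position h c).elim 0 (fun x => if x = b then (1 : ℝ) else 0) +
      (position h (par c)).elim 0 (fun y => if b ∈ Nplus y then (4 : ℝ) / d else 0)) with hg
  have hfirst : ∀ (b : V) (o : Option V), 0 ≤ o.elim 0 (fun x => if x = b then (1 : ℝ) else 0) := by
    intro b o
    cases o with
    | none => simp
    | some x => simp only [Option.elim]; split_ifs <;> norm_num
  have hsecond : ∀ (b : V) (o : Option V),
      0 ≤ o.elim 0 (fun y => if b ∈ Nplus y then (4 : ℝ) / d else 0) := by
    intro b o
    cases o with
    | none => simp
    | some x => simp only [Option.elim]; split_ifs <;> positivity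
  have hg0 : ∀ b, 0 ≤ g b := fun b => Finset.sum_nonneg fun c _ =>
    add_nonneg (hfirst b _) (hsecond b _)
  have hgγ : ∀ b, g b ≤ 1 + 4 * Fintype.card W / d := by
    intro b
    simp only [hg]
    rw [Finset.sum_add_distrib]
    refine add_le_add ?_ ?_
    · have h1 : ∀ c : W, (position h c).elim 0 (fun x => if x = b then (1 : ℝ) else 0) =
          if position h c = some b then 1 else 0 := by
        intro c
        cases position h c with
        | none => simp
        | some x => simp
      rw [Finset.sum_congr rfl fun c _ => h1 c, Finset.sum_boole]
      norm_cast
      rw [Finset.card_le_one]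
      intro c hc c' hc'
      simp only [Finset.mem_filter, Finset.mem_univ, true_and] at hc hc'
      exact hv.inj c c' b hc hc'
    · calc _ ≤ ∑ _c : W, (4 : ℝ) / d := by
            refine Finset.sum_le_sum fun c _ => ?_
            cases position h (par c) with
            | none => simp only [Option.elim]; positivity
            | some y =>
              simp only [Option.elim]
              split_ifs
              · exact le_rfl
              · positivity
        _ = _ := by
            rw [Finset.sum_const, nsmul_eq_mul, Finset.card_univ]
            ring
  have htouch : ∀ v, touch Nplus par d v h = ∑ b ∈ Nplus v, g b := by
    intro v
    simp only [hg]
    rw [Finset.sum_comm]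
    refine Finset.sum_congr rfl fun c _ => ?_
    unfold touchAt
    rw [Finset.sum_add_distrib]
    congr 1
    · cases position h c with
      | none => simp
      | some x => simp [hit]
    · cases position h (par c) with
      | none => simp
      | some y =>
        simp only [Option.elim, threat, overlap]
        rw [← Finset.sum_filter, Finset.sum_const, nsmul_eq_mul, Finset.filter_mem_eq_inter,
          Finset.inter_comm]
        ring
  have hG : ∑ b ∈ F.biUnion Nplus, g b ≤ 5 * Fintype.card W := by
    simp only [hg]
    rw [Finset.sum_comm]
    calc _ ≤ ∑ _c : W, (5 : ℝ) := by
          refine Finset.sum_le_sum fun c _ => ?_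
          rw [Finset.sum_add_distrib]
          have h1 : ∑ b ∈ F.biUnion Nplus,
              (position h c).elim 0 (fun x => if x = b then (1 : ℝ) else 0) ≤ 1 := by
            cases position h c with
            | none => simp
            | some x =>
              simp only [Option.elim, Finset.sum_ite_eq]
              split_ifs <;> norm_num
          have h2 : ∑ b ∈ F.biUnion Nplus,
              (position h (par c)).elim 0 (fun y => if b ∈ Nplus y then (4 : ℝ) / d else 0) ≤ 4 := by
            cases position h (par c) with
            | none => simp
            | some y =>
              simp only [Option.elim]
              rw [← Finset.sum_filter, Finset.sum_const, nsmul_eq_mul, ← mul_div_assoc,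
                div_le_iff₀ hd0, mul_comm]
              have h3 : ((F.biUnion Nplus).filter fun b => b ∈ Nplus y).card ≤ d := by
                rw [← hcard y]
                exact Finset.card_le_card fun b hb => (Finset.mem_filter.1 hb).2
              have : (((F.biUnion Nplus).filter fun b => b ∈ Nplus y).card : ℝ) ≤ d := by
                exact_mod_cast h3
              linarith
          linarith
      _ = _ := by
          rw [Finset.sum_const, nsmul_eq_mul, Finset.card_univ]
          ring
  have key := sum_pow_weight_le hg0 hgγ (by positivity) (F.biUnion Nplus) s t F Nplus
    (fun v hv => Finset.subset_biUnion_of_mem Nplus hv) (fun I hI => by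
      refine (card_lt_of_free hfree (I := I) hI.ge ?_).le
      intro v hv b hb
      exact hN v (by simpa using (Finset.mem_filter.1 hv).2 hb))
  calc (F.card : ℝ) * a ^ t = ∑ v ∈ F, a ^ t := by rw [Finset.sum_const, nsmul_eq_mul]
    _ ≤ _ := Finset.sum_le_sum fun v hvF => pow_le_pow_left₀ ha (by
        rw [← htouch]
        exact le_max_of_le_left (by linarith [hF v hvF])) _
    _ ≤ _ := key
    _ ≤ _ := by
        have : 0 ≤ ∑ b ∈ F.biUnion Nplus, g b := Finset.sum_nonneg fun b _ => hg0 b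
        gcongr

theorem sum_hit_le {Nplus : V → Finset V} {d : ℕ} {y v : V} {A : Finset V}
    (hA : A ⊆ Nplus y) (hAd : (d : ℝ) ≤ 2 * A.card) (hd : 0 < d) :
    ∑ x ∈ A, hit Nplus v x ≤ A.card * (threat Nplus d v y / 2) := by
  have hd0 : (0 : ℝ) < d := by exact_mod_cast hd
  unfold hit threat
  rw [Finset.sum_boole, Finset.filter_mem_eq_inter]
  have h1 : ((A ∩ Nplus v).card : ℝ) ≤ overlap Nplus y v := by
    exact_mod_cast Finset.card_le_card (Finset.inter_subset_inter_right hA)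
  refine h1.trans ?_
  have : (overlap Nplus y v : ℝ) = d * (overlap Nplus y v / d) := by field_simp
  have h2 : (0 : ℝ) ≤ (overlap Nplus y v : ℝ) / d := by positivity
  nlinarith

/-- The numerical conditions on `d` needed for the analysis; `q` and `ρ` stand for the `k`-th roots
of `d` and `s`. -/
structure Numerics (s k d : ℕ) (q ρ θ : ℝ) : Prop where
  large : 256 ≤ d
  θ_nonneg : 0 ≤ θ
  θ_le : θ ≤ 1
  one_le_q : 1 ≤ q
  one_le_ρ : 1 ≤ ρ
  q_pow : q ^ k = d
  ρ_pow : ρ ^ k = s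
  ρ_le : 17 * ρ ≤ d / 256
  q_le : 2 ≤ k → 2 * k * q ≤ d
  gap : k * (1 + q / ρ / 16 + 4 / d) ≤ 3 / 64 * d
  moment_two : k = 1 → (1 + 2 * θ) * (8 * (2 * ρ / q) +
    4 * (Real.exp (θ * d / 64) * (θ * d / 64) ^ 1 * (s / d) ^ 2)) ≤ 17 * ρ / q
  moment : 2 ≤ k → (1 + 2 * θ) * (8 * (2 * ρ / q) + 4 * (Real.exp (θ * d / 64) *
    (θ * d / 64) ^ (k - 1) * (2 ^ k * (2 * s + k ^ k) / d))) ≤ 17 * ρ / q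

/-- For `k ≥ 2` the `k`-th moment of the overlaps is small enough to beat `exp (θ * d / 64)`. For `k
= 1` it is not, but then overlaps are pointwise below `s` and the second moment serves. -/
theorem Numerics.average {G : SimpleGraph V} {s k d : ℕ} {q ρ θ : ℝ} (hk : 1 ≤ k)
    (hnum : Numerics s k d q ρ θ)
    (hfree : (completeBipartiteGraph (Fin s) (Fin (k + 1))).Free G) {Nplus : V → Finset V}
    (hcard : ∀ v, (Nplus v).card = d) (hN : ∀ v, (Nplus v : Set V) ⊆ G.neighborSet v)
    (y v : V) (A : Finset V) (c : ℝ) (hA : A ⊆ Nplus y) (hAd : (d : ℝ) ≤ 2 * A.card)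
    (hc0 : 0 ≤ c) (hc : c ≤ d / 256) :
    ∑ x ∈ A, Real.exp (θ * hit Nplus v x + 4 * θ * c * relOverlap Nplus d v x) ≤
      A.card * Real.exp (θ * threat Nplus d v y + θ * c * (17 * ρ / q)) := by
  have hd : 0 < d := by have := hnum.large; omega
  have hd0 : (0 : ℝ) < d := by exact_mod_cast hd
  have hq := hnum.one_le_q
  have hρ := hnum.one_le_ρ
  have hL : 4 * θ * c ≤ θ * d / 64 := by
    have := mul_le_mul_of_nonneg_left hc hnum.θ_nonneg
    linarith
  have hh := sum_hit_le (v := v) hA hAd hd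
  rcases Nat.lt_or_ge k 2 with hk2 | hk2
  · have hk1 : k = 1 := by omega
    subst hk1
    have hqd : q = d := by simpa using hnum.q_pow
    have hρs : ρ = s := by simpa using hnum.ρ_pow
    have hX : ∀ x ∈ A, relOverlap Nplus d v x ≤ s / d := fun x _ =>
      relOverlap_le_of_free hfree hN v x
    refine sum_exp_le hnum.θ_nonneg hnum.θ_le hc0 hL (by positivity)
      (fun x _ => hit_nonneg _ _ _) (fun x _ => hit_le_one _ _ _)
      (fun x _ => relOverlap_nonneg _ _ _ _) (fun x _ => relOverlap_le_one hcard _ _) hh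
      (m := 2 * ρ / q) (M := (s / d) ^ 2) (k := 1) ?_ ?_ (hnum.moment_two rfl)
    · refine (Finset.sum_le_card_nsmul A _ _ hX).trans ?_
      rw [nsmul_eq_mul, hqd, hρs]
      gcongr
      have : (0 : ℝ) ≤ s := by positivity
      linarith
    · rw [← nsmul_eq_mul]
      exact Finset.sum_le_card_nsmul A _ _ fun x hx =>
        pow_le_pow_left₀ (relOverlap_nonneg _ _ _ _) (hX x hx) _
  · have hk' : k - 1 + 1 = k := by omega
    refine sum_exp_le hnum.θ_nonneg hnum.θ_le hc0 hL (by positivity)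
      (fun x _ => hit_nonneg _ _ _) (fun x _ => hit_le_one _ _ _)
      (fun x _ => relOverlap_nonneg _ _ _ _) (fun x _ => relOverlap_le_one hcard _ _) hh
      ?_ ?_ (hnum.moment hk2)
    · exact sum_relOverlap_le hfree hcard hN hk2 hd hA hAd (by linarith) hnum.q_pow hρ
        hnum.ρ_pow (hnum.q_le hk2)
    · rw [hk']
      exact sum_relOverlap_pow_le hfree hcard hN hk hd hA hAd

theorem Numerics.controlled {G : SimpleGraph V} {s k d : ℕ} {q ρ θ : ℝ} (hk : 1 ≤ k)
    (hnum : Numerics s k d q ρ θ)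
    (hfree : (completeBipartiteGraph (Fin s) (Fin (k + 1))).Free G) {Nplus : V → Finset V}
    (hcard : ∀ v, (Nplus v).card = d) (hN : ∀ v, (Nplus v : Set V) ⊆ G.neighborSet v)
    {r : W} {par : W → W} (hroot : par r = r)
    (hdeg : ∀ u, ((Finset.univ.filter fun w => w ≠ r ∧ par w = u).card : ℝ) ≤ d / 256)
    (hW : (Fintype.card W : ℝ) ≤ q / ρ / 64 * d + 1) :
    Controlled Nplus r par d θ (17 * ρ / q) (s * 10 ^ (k + 1) * d ^ 2) := by
  have hd : 0 < d := by have := hnum.large; omega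
  have hd256 : (256 : ℝ) ≤ d := by exact_mod_cast hnum.large
  have hd0 : (0 : ℝ) < d := by exact_mod_cast hd
  have hq := hnum.one_le_q
  have hρ := hnum.one_le_ρ
  have hq0 : 0 < q := by linarith
  have hρ0 : 0 < ρ := by linarith
  refine ⟨hcard, hnum.large, hnum.θ_nonneg, by positivity, hroot, hdeg,
    hnum.average hk hfree hcard hN, ?_, ?_⟩
  · intro h hv F hF
    have hWd : 4 * (Fintype.card W : ℝ) / d ≤ q / ρ / 16 + 4 / d := by
      rw [div_le_iff₀ hd0, add_mul, div_mul_cancel₀ _ hd0.ne']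
      linarith
    -- Of the threshold `d / 16 = 4/64 * d`, the shift uses at most `3/64 * d`, leaving `a = d /
    -- 64`.
    have h1 := card_mul_pow_le_of_touch hfree hcard hN hd hv (a := d / 64) (by positivity) (by
      have := mul_le_mul_of_nonneg_left hWd (show (0 : ℝ) ≤ k by positivity)
      have := hnum.gap
      push_cast
      linarith) hF
    have hWq : 5 * (Fintype.card W : ℝ) ≤ 10 * q * (d / 64) := by
      have h2 : q / ρ ≤ q := div_le_self hq0.le hρ
      have h3 : q / ρ / 64 * d ≤ q / 64 * d := by gcongr
      have h4 : 256 ≤ q * d := by nlinarith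
      linarith
    have h5 : (F.card : ℝ) * (d / 64) ^ (k + 1) ≤
        s * (10 ^ (k + 1) * q ^ (k + 1)) * (d / 64) ^ (k + 1) := by
      refine h1.trans ?_
      rw [mul_assoc, ← mul_pow, ← mul_pow]
      gcongr
    have h6 := le_of_mul_le_mul_right h5 (by positivity)
    have hqd : q ≤ d := by
      rw [← hnum.q_pow]
      exact le_self_pow₀ hq (by omega)
    calc (F.card : ℝ) ≤ s * (10 ^ (k + 1) * q ^ (k + 1)) := h6
      _ = s * 10 ^ (k + 1) * (d * q) := by rw [pow_succ q, hnum.q_pow]; ring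
      _ ≤ s * 10 ^ (k + 1) * (d * d) := by gcongr
      _ = _ := by ring
  -- The main term is `68/256 * d`; the extra vertex beyond the number of edges costs at most `17 *
  -- ρ ≤ d / 256`.
  · calc 17 * ρ / q * Fintype.card W ≤ 17 * ρ / q * (q / ρ / 64 * d + 1) := by gcongr
      _ = 17 / 64 * d + 17 * ρ / q := by field_simp
      _ ≤ 17 / 64 * d + 17 * ρ := by
          gcongr
          exact div_le_self (by positivity) hq
      _ ≤ _ := by linarith [hnum.ρ_le]

end Heavy

/-! ### Large `d` -/

section Asymptotics

open Filter Topology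

theorem tendsto_log_pow_mul_rpow (j : ℕ) {a : ℝ} (ha : 0 < a) :
    Tendsto (fun d : ℕ => Real.log d ^ j * (d : ℝ) ^ (-a)) atTop (𝓝 0) := by
  have h := (isLittleO_log_rpow_rpow_atTop (j : ℝ) ha).tendsto_div_nhds_zero
  refine (h.comp tendsto_natCast_atTop_atTop).congr' ?_
  filter_upwards [eventually_ge_atTop 1] with d hd
  simp only [Function.comp, Real.rpow_natCast]
  rw [Real.rpow_neg (by positivity), div_eq_mul_inv]

/-- The parameter of the exponential moments. -/
noncomputable def rate (d : ℕ) : ℝ := 24 * Real.log d / d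

theorem tendsto_rate : Tendsto rate atTop (𝓝 0) := by
  have h := (tendsto_log_pow_mul_rpow 1 one_pos).const_mul 24
  rw [mul_zero] at h
  refine h.congr' ?_
  filter_upwards with d
  rw [rate, pow_one, Real.rpow_neg_one]
  ring

theorem rate_mul {d : ℕ} (hd : 0 < d) : rate d * d = 24 * Real.log d := by
  have : (d : ℝ) ≠ 0 := by positivity
  rw [rate, div_mul_cancel₀ _ this]

/-- With this rate `exp (θ * d / 64) = d^(3/8)`, so the higher moment term, after multiplication by
`q`, is `d^(-1/8)` up to logarithms. The main term tends to `16 * ρ`, which is why `17` is used in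
`κ`. -/
theorem eventually_moment (C : ℝ) {ρ : ℝ} (hρ : 0 < ρ) (j : ℕ) :
    ∀ᶠ d : ℕ in atTop, ∀ q M : ℝ, 0 < q → 0 ≤ M → q * M ≤ C * (d : ℝ) ^ (-(1 / 2) : ℝ) →
      (1 + 2 * rate d) * (8 * (2 * ρ / q) + 4 * (Real.exp (rate d * d / 64) *
        (rate d * d / 64) ^ j * M)) ≤ 17 * ρ / q := by
  have h1 : Tendsto (fun d : ℕ => (1 + 2 * rate d) * (16 * ρ + 4 * C * (3 / 8) ^ j *
      (Real.log d ^ j * (d : ℝ) ^ (-(1 / 8) : ℝ)))) atTop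
      (𝓝 ((1 + 2 * 0) * (16 * ρ + 4 * C * (3 / 8) ^ j * 0))) :=
    ((tendsto_rate.const_mul 2).const_add 1).mul
      (((tendsto_log_pow_mul_rpow j (by norm_num)).const_mul _).const_add _)
  have h2 := h1.eventually_le_const (u := 17 * ρ) (by nlinarith)
  filter_upwards [h2, eventually_ge_atTop 1] with d hd hd1 q M hq hM hqM
  have hd0 : (0 : ℝ) < d := by exact_mod_cast hd1
  have hlog : 0 ≤ Real.log d := Real.log_nonneg (by exact_mod_cast hd1)
  have hr0 : 0 ≤ rate d := by unfold rate; positivity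
  rw [rate_mul hd1, le_div_iff₀ hq]
  have hexp : Real.exp (24 * Real.log d / 64) = (d : ℝ) ^ (3 / 8 : ℝ) := by
    rw [Real.rpow_def_of_pos hd0]
    congr 1
    ring
  have hpow : (24 * Real.log d / 64) ^ j = (3 / 8) ^ j * Real.log d ^ j := by
    rw [← mul_pow]
    congr 1
    ring
  rw [hexp, hpow]
  refine le_trans ?_ hd
  rw [mul_assoc]
  refine mul_le_mul_of_nonneg_left ?_ (by linarith)
  have h3 : (d : ℝ) ^ (3 / 8 : ℝ) * (d : ℝ) ^ (-(1 / 2) : ℝ) = (d : ℝ) ^ (-(1 / 8) : ℝ) := by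
    rw [← Real.rpow_add hd0]
    norm_num
  rw [← h3]
  have h4 := mul_le_mul_of_nonneg_left hqM
    (show 0 ≤ 4 * ((d : ℝ) ^ (3 / 8 : ℝ) * ((3 / 8) ^ j * Real.log d ^ j)) by positivity)
  have h5 : 8 * (2 * ρ / q) * q = 16 * ρ := by field_simp; norm_num
  rw [add_mul, h5]
  linarith

theorem eventually_numerics {s k : ℕ} (hk : 1 ≤ k) (hs : 2 ≤ s) :
    ∀ᶠ d : ℕ in atTop, Numerics s k d ((d : ℝ) ^ (1 / (k : ℝ))) ((s : ℝ) ^ (1 / (k : ℝ)))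
      (rate d) := by
  have hk0 : (0 : ℝ) < k := by exact_mod_cast hk
  have hs1 : (1 : ℝ) ≤ s := by exact_mod_cast (by omega : 1 ≤ s)
  set ρ := (s : ℝ) ^ (1 / (k : ℝ)) with hρ
  have hρ1 : 1 ≤ ρ := Real.one_le_rpow hs1 (by positivity)
  have htop := tendsto_natCast_atTop_atTop (R := ℝ)
  have hhalf : ∀ C : ℝ, ∀ᶠ d : ℕ in atTop, C ≤ (d : ℝ) ^ (1 / 2 : ℝ) := fun C =>
    ((tendsto_rpow_atTop (by norm_num : (0 : ℝ) < 1 / 2)).comp htop).eventually_ge_atTop C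
  filter_upwards [eventually_ge_atTop 256, tendsto_rate.eventually_le_const one_pos,
    htop.eventually_ge_atTop (256 * (17 * ρ)), hhalf (200 * k),
    eventually_moment (s ^ 2) (by linarith : 0 < ρ) 1,
    eventually_moment (2 ^ k * (2 * s + k ^ k)) (by linarith : 0 < ρ) (k - 1)]
    with d h256 hrate hρd hroot hm1 hm2
  have hd1 : (256 : ℝ) ≤ d := by exact_mod_cast h256
  have hd0 : (0 : ℝ) < d := by linarith
  set q := (d : ℝ) ^ (1 / (k : ℝ)) with hq
  have hq1 : 1 ≤ q := Real.one_le_rpow (by linarith) (by positivity)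
  have hqk : q ^ k = d := by
    rw [hq, ← Real.rpow_mul_natCast hd0.le, one_div_mul_cancel hk0.ne', Real.rpow_one]
  have hρk : ρ ^ k = s := by
    rw [hρ, ← Real.rpow_mul_natCast (by linarith), one_div_mul_cancel hk0.ne', Real.rpow_one]
  have hq2 : 2 ≤ k → q ≤ (d : ℝ) ^ (1 / 2 : ℝ) := by
    intro hk2
    have : (2 : ℝ) ≤ k := by exact_mod_cast hk2
    exact Real.rpow_le_rpow_of_exponent_le (by linarith) (by gcongr)
  have hsq : (d : ℝ) ^ (1 / 2 : ℝ) * (d : ℝ) ^ (1 / 2 : ℝ) = d := by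
    rw [← Real.rpow_add hd0]
    norm_num
  have hinv : (d : ℝ) ^ (1 / 2 : ℝ) / d = (d : ℝ) ^ (-(1 / 2) : ℝ) := by
    rw [div_eq_iff hd0.ne', ← Real.rpow_add_one hd0.ne']
    norm_num
  have hsq1 : 1 ≤ (d : ℝ) ^ (1 / 2 : ℝ) := Real.one_le_rpow (by linarith) (by norm_num)
  set D := (d : ℝ) ^ (1 / 2 : ℝ) with hD
  have hkD : 200 * k * D ≤ d := by
    rw [← hsq]
    gcongr
  have h4d : 4 / (d : ℝ) ≤ 1 := by
    rw [div_le_one hd0]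
    linarith
  refine ⟨h256, ?_, hrate, hq1, hρ1, hqk, hρk, by linarith, ?_, ?_, ?_, ?_⟩
  · have := Real.log_nonneg (by linarith : (1 : ℝ) ≤ d)
    unfold rate
    positivity
  · intro hk2
    have := mul_le_mul_of_nonneg_left (hq2 hk2) (by positivity : (0 : ℝ) ≤ 2 * k)
    nlinarith
  · rcases Nat.lt_or_ge k 2 with hk2 | hk2
    · have hk1 : k = 1 := by omega
      subst hk1
      have hqd : q = d := by simpa using hqk
      have hρs : ρ = s := by simpa using hρk
      -- For `k = 1` the term `q / ρ / 16` is itself linear in `d`; `s ≥ 2` bounds it by `d / 32`,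
      -- within the allowed `3/64 * d`.
      have hρ2 : 2 ≤ ρ := by rw [hρs]; exact_mod_cast hs
      have : q / ρ ≤ d / 2 := by rw [hqd]; gcongr
      push_cast
      linarith
    · have h1 : q / ρ ≤ D := (div_le_self (by linarith) hρ1).trans (hq2 hk2)
      have h2 : (k : ℝ) * (1 + q / ρ / 16 + 4 / d) ≤ k * (3 * D) := by
        gcongr
        linarith
      linarith
  · intro hk1
    subst hk1
    have hqd : q = d := by simpa using hqk
    refine hm1 q _ (zero_lt_one.trans_le hq1) (by positivity) ?_
    rw [← hinv, hqd]
    calc (d : ℝ) * (s / d) ^ 2 = s ^ 2 * (1 / d) := by field_simp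
      _ ≤ _ := by gcongr
  · intro hk2
    refine hm2 q _ (by linarith) (by positivity) ?_
    rw [← hinv]
    calc q * (2 ^ k * (2 * s + k ^ k) / d) = 2 ^ k * (2 * s + k ^ k) * (q / d) := by ring
      _ ≤ _ := by
        gcongr
        exact hq2 hk2

/-- Since `24 * 33 / 256 > 3`, the exponential is at most `d^(-3)`, which beats the `d^2` heavy
vertices. -/
theorem eventually_failure_le (C : ℝ) {ε : ℝ} (hε : 0 < ε) :
    ∀ᶠ d : ℕ in atTop, C * (d : ℝ) ^ 2 * Real.exp (-(rate d * (33 / 256 * d))) ≤ ε := by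
  have h := (tendsto_log_pow_mul_rpow 0 one_pos).const_mul |C|
  rw [mul_zero] at h
  filter_upwards [h.eventually_le_const hε, eventually_ge_atTop 1] with d hd hd1
  have hd0 : (0 : ℝ) < d := by exact_mod_cast hd1
  have hlog : 0 ≤ Real.log d := Real.log_nonneg (by exact_mod_cast hd1)
  refine le_trans ?_ hd
  have h1 : Real.exp (-(rate d * (33 / 256 * d))) ≤ (d : ℝ) ^ (-3 : ℝ) := by
    rw [Real.rpow_def_of_pos hd0, Real.exp_le_exp]
    have := rate_mul (d := d) hd1
    nlinarith
  have h2 : (d : ℝ) ^ 2 * (d : ℝ) ^ (-3 : ℝ) = (d : ℝ) ^ (-1 : ℝ) := by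
    rw [← Real.rpow_natCast, ← Real.rpow_add hd0]
    norm_num
  calc C * (d : ℝ) ^ 2 * Real.exp (-(rate d * (33 / 256 * d)))
      ≤ |C| * (d : ℝ) ^ 2 * (d : ℝ) ^ (-3 : ℝ) := by
        gcongr
        exact le_abs_self C
    _ = _ := by rw [mul_assoc, h2, pow_zero, one_mul]

end Asymptotics

end TreeEmbedding

/-! ### The theorem -/

theorem theorem3p3 (s t : ℕ) (ht : 2 ≤ t) (hst : t ≤ s) :
    ∀ ε : ℝ, 0 < ε → ∃ d₀ : ℕ, ∀ d : ℕ, d₀ ≤ d →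
      ∀ (V : Type*) (G : SimpleGraph V),
        (completeBipartiteGraph (Fin s) (Fin t)).Free G →
        (∀ v, (d : ℕ∞) ≤ (G.neighborSet v).encard) →
      ∀ (W : Type*) [Fintype W] (T : SimpleGraph W) [DecidableRel T.Adj],
        T.IsTree →
        (T.edgeSet.ncard : ℝ) ≤
          1 / 64 * (s : ℝ) ^ (-(1 / ((t : ℝ) - 1))) * (d : ℝ) ^ ((t : ℝ) / ((t : ℝ) - 1)) →
        (T.maxDegree : ℝ) ≤ 1 / 256 * (d : ℝ) →
      ∀ Nplus : V → Finset V,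
        (∀ v, (Nplus v).card = d ∧ (Nplus v : Set V) ⊆ G.neighborSet v) →
      ∀ (r : W) (x₀ : V) (σ : TreeEmbedding.Schedule T r V),
        1 - ENNReal.ofReal ε ≤
          (TreeEmbedding.embedTree Nplus x₀ σ).toOuterMeasure
            (TreeEmbedding.foundEmbedding T G) := by
  intro ε hε
  obtain ⟨k, rfl⟩ : ∃ k, t = k + 1 := ⟨t - 1, by omega⟩
  have hk : 1 ≤ k := by omega
  obtain ⟨d₀, hd₀⟩ := Filter.eventually_atTop.1
    ((TreeEmbedding.eventually_numerics hk (by omega : 2 ≤ s)).and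
      (TreeEmbedding.eventually_failure_le (s * 10 ^ (k + 1)) hε))
  refine ⟨d₀, fun d hd V G hfree _ W _ T _ hT hE hΔ Nplus hN r x₀ σ => ?_⟩
  obtain ⟨hnum, hfail⟩ := hd₀ d hd
  obtain ⟨par, hpar⟩ := TreeEmbedding.exists_isParentMap hT r
  have hk0 : (0 : ℝ) < k := by exact_mod_cast hk
  have hd0 : (0 : ℝ) < d := by
    have := hnum.large
    exact_mod_cast (by omega : 0 < d)
  refine (hnum.controlled hk hfree (fun v => (hN v).1) (fun v => (hN v).2) hpar.root ?_ ?_).embedTree_ge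
    hpar (fun v => (hN v).2) σ x₀ hfail
  · classical
    intro u
    have h1 : (Finset.univ.filter fun w => w ≠ r ∧ par w = u).card ≤ T.maxDegree := by
      refine le_trans (Finset.card_le_card ?_) (T.degree_le_maxDegree u)
      intro w hw
      rw [SimpleGraph.mem_neighborFinset]
      obtain ⟨hwr, rfl⟩ := (Finset.mem_filter.1 hw).2
      exact hpar.adj w hwr
    have h2 : ((Finset.univ.filter fun w => w ≠ r ∧ par w = u).card : ℝ) ≤ T.maxDegree := by
      exact_mod_cast h1
    convert h2.trans (hΔ.trans_eq (one_div_mul_eq_div _ _))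
  · classical
    have hW : T.edgeSet.ncard + 1 = Fintype.card W := by
      rw [← hT.card_edgeFinset, ← SimpleGraph.coe_edgeFinset, Set.ncard_coe_finset]
    have hW' : (Fintype.card W : ℝ) = T.edgeSet.ncard + 1 := by exact_mod_cast hW.symm
    rw [hW']
    -- With `t = k + 1` the edge bound `s^(-1/k) * d^(1 + 1/k) / 64` is `q / ρ / 64 * d`.
    refine add_le_add (hE.trans (le_of_eq ?_)) le_rfl
    have h1 : (((k + 1 : ℕ) : ℝ) - 1) = k := by push_cast; ring
    have h2 : ((k + 1 : ℕ) : ℝ) / k = 1 / k + 1 := by push_cast; field_simp; ring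
    rw [h1, h2, Real.rpow_neg (by positivity), Real.rpow_add_one hd0.ne']
    ring
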